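/- Let $K$ be a number field with ring of integers $\mathcal{O}_K$, and for a nonzero ideal $\mathfrak{a}$ of $\mathcal{O}_K$ let $\mathfrak{N}\mathfrak{a}=|\mathcal{O}_K/\mathfrak{a}|$. Let $\zeta_K(s)=\sum_{\mathfrak{a}\neq 0}\mathfrak{N}\mathfrak{a}^{-s}$ (for $\Re s>1$) be the Dedekind zeta function of $K$, and denote its meromorphic continuation to $\mathbb{C}$, which is holomorphic except at $s=1$, by $\zeta_K$ as well. Assume the Extended Lindelöf Hypothesis for $K$: for every $\varepsilon>0$ we have $\zeta_K(\sigma+it)=O(t^{\varepsilon})$ as $t\to\infty$, uniformly for $\sigma\ge 1/2$. For an integer $m\ge 2$ and real $x$, let $V_m(x,K)$ be the number of $m$-tuples $(\mathfrak{a}_1,\dots,\mathfrak{a}_m)$ of nonzero ideals of $\mathcal{O}_K$ with $\mathfrak{a}_1+\cdots+\mathfrak{a}_m=\mathcal{O}_K$ and $\mathfrak{N}\mathfrak{a}_i\le x$ for all $i$, and let $$E_m(x,K)=V_m(x,K)-\frac{(cx)^m}{\zeta_K(m)},\qquad c=\frac{2^{r_1}(2\pi)^{r_2}hR}{w\sqrt{|d_K|}},$$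 where $r_1$ and $r_2$ are the numbers of real and complex places of $K$, $h$ is its class number, $R$ its regulator, $w$ the number of roots of unity in $K$, and $d_K$ its discriminant. Then, for every $m\ge 2$ and every $\varepsilon>0$, $$E_m(x,K)=O\!\left(x^{m-1/2+\varepsilon}\right)\qquad(x\to\infty),$$ where the implied constant may depend on $K$, $m$ and $\varepsilon$. -/

import Mathlib

open Filter Asymptotics NumberField

/-- `Z` is the meromorphic continuation to `ℂ` of the Dedekind zeta function of `K`: it is
holomorphic away from `s = 1`, meromorphic at `s = 1`, and given on `Re s > 1` by the Dirichlet
series of `K`. Such a `Z` is unique on `ℂ ∖ {1}`, see `IsDedekindZetaContinuation.eqOn`. -/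
structure IsDedekindZetaContinuation (K : Type*) [Field K] [NumberField K] (Z : ℂ → ℂ) :
    Prop where
  differentiableOn : DifferentiableOn ℂ Z {1}ᶜ
  meromorphicAt_one : MeromorphicAt Z 1
  eq_dedekindZeta : ∀ s : ℂ, 1 < s.re → Z s = dedekindZeta K s

theorem IsDedekindZetaContinuation.eqOn {K : Type*} [Field K] [NumberField K] {Z W : ℂ → ℂ}
    (hZ : IsDedekindZetaContinuation K Z) (hW : IsDedekindZetaContinuation K W) :
    Set.EqOn Z W {1}ᶜ := by
  have hopen : IsOpen ({1}ᶜ : Set ℂ) := isOpen_compl_singleton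
  have hconn : IsPreconnected ({1}ᶜ : Set ℂ) :=
    (isConnected_compl_singleton_of_one_lt_rank (by simp) (1 : ℂ)).isPreconnected
  refine (hZ.differentiableOn.analyticOnNhd hopen).eqOn_of_preconnected_of_eventuallyEq
    (hW.differentiableOn.analyticOnNhd hopen) hconn (z₀ := 2) (by simp) ?_
  have h : {s : ℂ | 1 < s.re} ∈ nhds (2 : ℂ) :=
    (isOpen_lt continuous_const Complex.continuous_re).mem_nhds (by simp)
  filter_upwards [h] with s hs
  rw [hZ.eq_dedekindZeta s hs, hW.eq_dedekindZeta s hs]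

/-- The Extended Lindelöf Hypothesis for `K`: the meromorphic continuation of `ζ_K` satisfies
`ζ_K(σ + it) = O(t ^ ε)` as `t → ∞`, for `σ ≥ 1/2` and every `ε > 0`. -/
def ExtendedLindelofHypothesis (K : Type*) [Field K] [NumberField K] : Prop :=
  ∃ Z : ℂ → ℂ, IsDedekindZetaContinuation K Z ∧
    ∀ ε : ℝ, 0 < ε → ∃ C t₀ : ℝ, ∀ σ t : ℝ, 1 / 2 ≤ σ → t₀ ≤ t →
      ‖Z ((σ : ℂ) + (t : ℂ) * Complex.I)‖ ≤ C * t ^ ε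

/-- The `m`-tuples of nonzero ideals of norm at most `x` that are visible from the origin, that is,
whose sum is the whole ring of integers. -/
def visiblePoints (K : Type*) [Field K] [NumberField K] (m : ℕ) (x : ℝ) :
    Set (Fin m → Ideal (𝓞 K)) :=
  {a | (∀ i, a i ≠ ⊥) ∧ (∀ i, (Ideal.absNorm (a i) : ℝ) ≤ x) ∧ ∑ i, a i = ⊤}

theorem visiblePoints_finite (K : Type*) [Field K] [NumberField K] (m : ℕ) (x : ℝ) :
    (visiblePoints K m x).Finite := by
  have h : {I : Ideal (𝓞 K) | Ideal.absNorm I ≤ ⌊x⌋₊}.Finite :=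
    Ideal.finite_setOfPred_absNorm_le ⌊x⌋₊
  refine (Set.Finite.pi' (fun _ : Fin m => h)).subset fun a ha i => ?_
  exact Nat.le_floor (ha.2.1 i)

/-- The number `V_m(x, K)` of visible lattice points. -/
noncomputable def visibleCount (K : Type*) [Field K] [NumberField K] (m : ℕ) (x : ℝ) : ℕ :=
  (visiblePoints K m x).ncard

/-- The error term `E_m(x, K) = V_m(x, K) - (c x) ^ m / ζ_K(m)`, where
`c = 2 ^ r₁ (2π) ^ r₂ h R / (w √|d_K|)`, which is `dedekindZeta_residue K` by definition. It is used for `m ≥ 2`, where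
`dedekindZeta K m` is the sum of a convergent Dirichlet series. -/
noncomputable def visibleError (K : Type*) [Field K] [NumberField K] (m : ℕ) (x : ℝ) : ℂ :=
  (visibleCount K m x : ℂ) - ((dedekindZeta_residue K * x : ℝ) : ℂ) ^ m / dedekindZeta K (m : ℂ)

/-! Let `N(y)` count the nonzero ideals of norm at most `y`. Möbius inversion over finite sets `T`
of primes, which stand for the squarefree ideals `P_T` with `μ = (-1)^|T|`, gives `V_m(x) = ∑_T
(-1)^|T| N(x / 𝔑P_T)^m` (`hasSum_visibleCount`). Replacing `N(y)` by `c y` turns this into `(c x)^m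
∑_T (-1)^|T| (𝔑P_T)^(-m) = (c x)^m / ζ_K(m)`. If `N(y) = c y + O(y^(1/2+δ))`, then `N(y)^m = (c y)^m
+ O(y^(m-1/2+δ))`, and the errors add up to `O(x^(m-1/2+δ))` because `∑_T (𝔑P_T)^(-(m-1/2+δ))`
converges for `m ≥ 2`.

The estimate of `N` is where the Lindelöf hypothesis enters (`exists_abs_ncard_sub_le`). Perron's
formula for a sharp cutoff converges only conditionally, so the Riesz mean `A(x) = ∑ max(x - 𝔑𝔞, 0)`
is used, with absolutely integrable kernel `x^(s+1) / (s(s+1))`; one recovers `N` from `A(x) -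
A(x-1) ≤ N(x) ≤ A(x+1) - A(x)`. Write `ζ_K = F + c/(s-1)` with `F` entire. The polar part is
integrated in closed form, and the integral of `F` is moved to `Re s = 1/2`. There the differenced
kernel is `O((1+|t|)^(-1-δ) x^(1/2+δ))`, while `F = O((1+|t|)^η)` with `η < δ`, so the integral is
`O(x^(1/2+δ))`. -/

section

open scoped nonZeroDivisors
open IsDedekindDomain

/-! ### The Dedekind zeta function as a sum over nonzero ideals. -/

theorem natCard_nonZeroDivisors_absNorm_eq (K : Type*) [Field K] [NumberField K] {n : ℕ}
    (hn : n ≠ 0) :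
    Nat.card {I : (Ideal (𝓞 K))⁰ // Ideal.absNorm (I : Ideal (𝓞 K)) = n} =
      Nat.card {I : Ideal (𝓞 K) // Ideal.absNorm I = n} := by
  refine Nat.card_congr
    { toFun := fun I => ⟨I.1, I.2⟩
      invFun := fun I => ⟨⟨I.1, mem_nonZeroDivisors_iff_ne_zero.2 ?_⟩, I.2⟩
      left_inv := fun _ => rfl
      right_inv := fun _ => rfl }
  intro h
  have := I.2
  rw [h] at this
  exact hn (by simpa using this.symm)

theorem lseriesSummable_natCard_absNorm (K : Type*) [Field K] [NumberField K] {s : ℂ}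
    (hs : 1 < s.re) :
    LSeriesSummable (fun n ↦ (Nat.card {I : Ideal (𝓞 K) // Ideal.absNorm I = n} : ℂ)) s := by
  have h := LSeriesSummable_of_sum_norm_bigO_and_nonneg (s := s) (r := 1)
    (f := fun n ↦ (Nat.card {I : Ideal (𝓞 K) // Ideal.absNorm I = n} : ℝ)) ?_
    (fun _ ↦ Nat.cast_nonneg _) zero_le_one hs
  · simpa using h
  refine isBigO_atTop_natCast_rpow_of_tendsto_div_rpow (a := dedekindZeta_residue K) ?_
  simp only [Real.rpow_one]
  refine ((Ideal.tendsto_norm_le_div_atTop₀ K).comp tendsto_natCast_atTop_atTop).congr fun n ↦ ?_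
  simp only [Function.comp_apply, Nat.cast_le, ← Nat.cast_sum]
  congr
  -- The zero ideal has norm 0: it is the extra 1, and it supplies the term `k = 0` of the sum over
  -- norms.
  rw [← add_left_inj 1, ← Ideal.card_norm_le_eq_card_norm_le_add_one,
    show Finset.Icc 1 n = Finset.Ioc 0 n from Finset.Icc_succ_left_eq_Ioc _ _,
    show 1 = Nat.card {I : Ideal (𝓞 K) // Ideal.absNorm I = 0} by
      simp [Ideal.absNorm_eq_zero_iff],
    Finset.sum_Ioc_add_eq_sum_Icc (n.zero_le),
    ← Finset.card_preimage_eq_sum_card_image_eq (fun k _ ↦ Ideal.finite_setOfPred_absNorm_eq k)]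
  simp [Set.coe_eq_subtype]

instance finite_nonZeroDivisors_absNorm_eq (K : Type*) [Field K] [NumberField K] (n : ℕ) :
    Finite {I : (Ideal (𝓞 K))⁰ // Ideal.absNorm (I : Ideal (𝓞 K)) = n} := by
  have : Finite {I : Ideal (𝓞 K) // Ideal.absNorm I = n} := Ideal.finite_setOfPred_absNorm_eq n
  exact Finite.of_injective
    (fun I => (⟨I.1, I.2⟩ : {I : Ideal (𝓞 K) // Ideal.absNorm I = n}))
    fun I J h => Subtype.ext (Subtype.ext (congrArg (fun I => I.1) h))

theorem hasSum_fiber_absNorm_cpow (K : Type*) [Field K] [NumberField K] (s : ℂ) (n : ℕ) :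
    HasSum (fun I : {I : (Ideal (𝓞 K))⁰ // Ideal.absNorm (I : Ideal (𝓞 K)) = n} =>
      ((Ideal.absNorm (I.1 : Ideal (𝓞 K)) : ℕ) : ℂ) ^ (-s))
      (LSeries.term (fun n ↦ (Nat.card {I : Ideal (𝓞 K) // Ideal.absNorm I = n} : ℂ)) s n) := by
  cases nonempty_fintype {I : (Ideal (𝓞 K))⁰ // Ideal.absNorm (I : Ideal (𝓞 K)) = n}
  convert! hasSum_fintype _ using 1
  -- At `n = 0` the L-series term is 0 by convention and the fiber is empty.
  rcases eq_or_ne n 0 with rfl | hn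
  · rw [LSeries.term_zero]
    have : IsEmpty {I : (Ideal (𝓞 K))⁰ // Ideal.absNorm (I : Ideal (𝓞 K)) = 0} :=
      ⟨fun I => Ideal.absNorm_ne_zero_of_nonZeroDivisors I.1 I.2⟩
    simp
  · rw [LSeries.term_of_ne_zero hn, Finset.sum_congr rfl (fun I _ => by rw [I.2]),
      Finset.sum_const, Finset.card_univ, ← Nat.card_eq_fintype_card,
      natCard_nonZeroDivisors_absNorm_eq K hn, nsmul_eq_mul, Complex.cpow_neg, div_eq_mul_inv]

theorem summable_absNorm_rpow (K : Type*) [Field K] [NumberField K] {σ : ℝ} (hσ : 1 < σ) :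
    Summable fun I : (Ideal (𝓞 K))⁰ => (Ideal.absNorm (I : Ideal (𝓞 K)) : ℝ) ^ (-σ) := by
  rw [← (Equiv.sigmaFiberEquiv
    fun I : (Ideal (𝓞 K))⁰ => Ideal.absNorm (I : Ideal (𝓞 K))).summable_iff]
  refine (summable_sigma_of_nonneg fun I => Real.rpow_nonneg (Nat.cast_nonneg _) _).2
    ⟨fun n => Summable.of_finite, ?_⟩
  have h := (lseriesSummable_natCard_absNorm K (s := (σ : ℂ)) (by simpa)).norm
  refine h.congr fun n => ?_
  have h1 := (hasSum_fiber_absNorm_cpow K (σ : ℂ) n).tsum_eq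
  have h2 : ∀ k : ℕ, (k : ℂ) ^ (-(σ : ℂ)) = (((k : ℝ) ^ (-σ) : ℝ) : ℂ) := fun k => by
    rw [Complex.ofReal_cpow (Nat.cast_nonneg _)]; simp
  simp only [h2] at h1
  rw [← Complex.ofReal_tsum] at h1
  rw [← h1, Complex.norm_real, Real.norm_of_nonneg
    (tsum_nonneg fun I => Real.rpow_nonneg (Nat.cast_nonneg _) _)]
  rfl

theorem hasSum_absNorm_cpow (K : Type*) [Field K] [NumberField K] {s : ℂ} (hs : 1 < s.re) :
    HasSum (fun I : (Ideal (𝓞 K))⁰ => ((Ideal.absNorm (I : Ideal (𝓞 K)) : ℕ) : ℂ) ^ (-s))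
      (dedekindZeta K s) := by
  rw [← (Equiv.sigmaFiberEquiv
    fun I : (Ideal (𝓞 K))⁰ => Ideal.absNorm (I : Ideal (𝓞 K))).hasSum_iff]
  refine HasSum.sigma_of_hasSum (lseriesSummable_natCard_absNorm K hs).hasSum
    (hasSum_fiber_absNorm_cpow K s) ?_
  refine (Equiv.summable_iff _).2 (Summable.of_norm ((summable_absNorm_rpow K hs).congr ?_))
  intro I
  rw [Complex.norm_natCast_cpow_of_pos (Ideal.absNorm_pos_of_nonZeroDivisors I)]
  simp

/-! ### Mellin transforms behind the Riesz mean. -/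

open MeasureTheory Complex Set in
theorem hasMellin_one_sub_Ioc {s : ℂ} (hs : 0 < s.re) :
    HasMellin (indicator (Ioc 0 1) fun t : ℝ => (1 : ℂ) - t) s (1 / (s * (s + 1))) := by
  have h1 := hasMellin_one_Ioc hs
  have h2 := hasMellin_cpow_Ioc 1 (s := s) (by simp; linarith)
  have h := hasMellin_sub h1.1 h2.1
  rw [h1.2, h2.2] at h
  have e : (fun t => indicator (Ioc 0 1) (fun _ => 1 : ℝ → ℂ) t -
      indicator (Ioc 0 1) (fun t => (t : ℂ) ^ (1 : ℂ) : ℝ → ℂ) t) =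
      indicator (Ioc 0 1) fun t : ℝ => (1 : ℂ) - t := by
    ext t
    by_cases ht : t ∈ Ioc (0 : ℝ) 1 <;> simp [ht]
  rw [e] at h
  convert! h using 1
  have h0 : s ≠ 0 := by rintro rfl; simp at hs
  have h0' : s + 1 ≠ 0 := by
    intro h; have := congrArg re h; simp at this; linarith
  field_simp
  ring

-- Partial fractions: `(1-t)²/(2t) = t/2 + 1/(2t) - 1`. The factor `1/(s-1)` will represent the pole
-- of `ζ_K`.
open MeasureTheory Complex Set in
theorem hasMellin_one_sub_sq_div_Ioc {s : ℂ} (hs : 1 < s.re) :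
    HasMellin (indicator (Ioc 0 1) fun t : ℝ => ((1 : ℂ) - t) ^ 2 / (2 * t)) s
      (1 / ((s - 1) * (s * (s + 1)))) := by
  have h1 := hasMellin_one_Ioc (s := s) (by linarith)
  have h2 := hasMellin_cpow_Ioc 1 (s := s) (by simp; linarith)
  have h3 := hasMellin_cpow_Ioc (-1) (s := s) (by simp; linarith)
  have g2 := hasMellin_const_smul h2.1 (1 / 2 : ℂ)
  have g3 := hasMellin_const_smul h3.1 (1 / 2 : ℂ)
  have g := hasMellin_add g2.1 g3.1
  have h := hasMellin_sub g.1 h1.1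
  rw [g.2, g2.2, g3.2, h1.2, h2.2, h3.2] at h
  have e : (fun t => (1 / 2 : ℂ) • indicator (Ioc 0 1) (fun t => (t : ℂ) ^ (1 : ℂ) : ℝ → ℂ) t +
      (1 / 2 : ℂ) • indicator (Ioc 0 1) (fun t => (t : ℂ) ^ (-1 : ℂ) : ℝ → ℂ) t -
      indicator (Ioc 0 1) (fun _ => 1 : ℝ → ℂ) t) =
      indicator (Ioc 0 1) fun t : ℝ => ((1 : ℂ) - t) ^ 2 / (2 * t) := by
    ext t
    by_cases ht : t ∈ Ioc (0 : ℝ) 1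
    · have : (t : ℂ) ≠ 0 := by exact_mod_cast ht.1.ne'
      simp [ht, cpow_neg_one]
      field_simp
      ring
    · simp [ht]
  rw [e] at h
  convert! h using 1
  have h0 : s ≠ 0 := by rintro rfl; simp at hs; linarith
  have h0' : s + 1 ≠ 0 := by
    intro h; have := congrArg re h; simp at this; linarith
  have h0'' : s - 1 ≠ 0 := by
    intro h; have := congrArg re h; simp at this; linarith
  have h0''' : s + -1 ≠ 0 := by rwa [← sub_eq_add_neg]
  simp only [smul_eq_mul]
  field_simp
  ring

theorem one_add_abs_le_norm {σ t : ℝ} (hσ : 1 / 2 ≤ σ) :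
    1 + |t| ≤ 3 * ‖(σ : ℂ) + t * Complex.I‖ := by
  have h1 := Complex.abs_re_le_norm ((σ : ℂ) + t * Complex.I)
  have h2 := Complex.abs_im_le_norm ((σ : ℂ) + t * Complex.I)
  simp at h1 h2
  have := le_abs_self σ
  linarith

theorem one_add_abs_le_norm_add_one {σ t : ℝ} (hσ : 1 / 2 ≤ σ) :
    1 + |t| ≤ 2 * ‖(σ : ℂ) + t * Complex.I + 1‖ := by
  have h1 := Complex.abs_re_le_norm ((σ : ℂ) + t * Complex.I + 1)
  have h2 := Complex.abs_im_le_norm ((σ : ℂ) + t * Complex.I + 1)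
  simp at h1 h2
  have := le_abs_self (σ + 1)
  linarith

theorem norm_inv_mul_add_one_le {σ t : ℝ} (hσ : 1 / 2 ≤ σ) :
    ‖((σ : ℂ) + t * Complex.I) * ((σ : ℂ) + t * Complex.I + 1)‖⁻¹ ≤ 6 * (1 + |t|) ^ (-2 : ℝ) := by
  have h1 := one_add_abs_le_norm (t := t) hσ
  have h2 := one_add_abs_le_norm_add_one (t := t) hσ
  have h0 : 0 < 1 + |t| := by positivity
  have h3 : (1 + |t|) * (1 + |t|) ≤
      (3 * ‖(σ : ℂ) + t * Complex.I‖) * (2 * ‖(σ : ℂ) + t * Complex.I + 1‖) := by gcongr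
  rw [Real.rpow_neg h0.le, Real.rpow_two, norm_mul, ← inv_inv (6 : ℝ), ← mul_inv]
  refine inv_anti₀ (by positivity) ?_
  nlinarith

theorem integrable_one_add_abs_rpow {r : ℝ} (hr : 1 < r) :
    MeasureTheory.Integrable fun t : ℝ => (1 + |t|) ^ (-r) := by
  simpa using! integrable_one_add_norm (E := ℝ) (μ := MeasureTheory.volume) (r := r) (by simpa)

theorem add_mul_I_ne_of_re_lt {σ t : ℝ} {a : ℂ} (h : a.re < σ) :
    (σ : ℂ) + t * Complex.I ≠ a := by
  rintro rfl
  simp at h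

open MeasureTheory Complex Set in
theorem verticalIntegrable_of_norm_le {g : ℂ → ℂ} {σ C : ℝ}
    (hg : Continuous fun t : ℝ => g (σ + t * I))
    (hC : ∀ t : ℝ, ‖g (σ + t * I)‖ ≤ C * (1 + |t|) ^ (-2 : ℝ)) : VerticalIntegrable g σ :=
  ((integrable_one_add_abs_rpow one_lt_two).const_mul C).mono' hg.aestronglyMeasurable
    (Eventually.of_forall hC)

open MeasureTheory Complex Set in
theorem mellinInv_inv_mul_add_one {u : ℝ} (hu : 0 < u) :
    mellinInv 2 (fun s => 1 / (s * (s + 1))) u = ((max (1 - u) 0 : ℝ) : ℂ) := by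
  set f : ℝ → ℂ := indicator (Ioc 0 1) fun t : ℝ => (1 : ℂ) - t with hf
  have hfu : ∀ v : ℝ, 0 < v → f v = ((max (1 - v) 0 : ℝ) : ℂ) := by
    intro v hv
    by_cases h : v ≤ 1
    · rw [hf, indicator_of_mem (show v ∈ Ioc (0 : ℝ) 1 from ⟨hv, h⟩), max_eq_left (by linarith)]
      push_cast
      rfl
    · rw [hf, indicator_of_notMem (fun h' => h h'.2), max_eq_right (by linarith)]; simp
  have hmel : ∀ t : ℝ, mellin f ((2 : ℝ) + t * I) =
      1 / (((2 : ℝ) + t * I) * ((2 : ℝ) + t * I + 1)) := fun t =>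
    (hasMellin_one_sub_Ioc (by simp)).2
  have h := mellinInv_mellin_eq 2 f hu (hasMellin_one_sub_Ioc (by simp)).1 ?_ ?_
  · rw [← hfu u hu, ← h]
    simp only [mellinInv, hmel]
  · refine verticalIntegrable_of_norm_le (C := 6) ?_ fun t => ?_
    · simp_rw [hmel]
      refine continuous_const.div (by fun_prop) fun t => mul_ne_zero ?_ ?_
      · exact add_mul_I_ne_of_re_lt (by simp)
      · rw [Ne, add_eq_zero_iff_eq_neg]; exact add_mul_I_ne_of_re_lt (by norm_num)
    · rw [hmel, norm_div, norm_one, one_div]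
      exact norm_inv_mul_add_one_le (by norm_num)
  -- Pointwise inversion needs continuity, also at `u = 1`; the truncated function has no jump
  -- there.
  · have : ContinuousAt (fun v : ℝ => ((max (1 - v) 0 : ℝ) : ℂ)) u := by fun_prop
    refine this.congr ?_
    filter_upwards [lt_mem_nhds hu] with v hv using (hfu v hv).symm

open MeasureTheory Complex Set in
theorem mellinInv_inv_sub_one_mul {u : ℝ} (hu : 0 < u) :
    mellinInv 2 (fun s => 1 / ((s - 1) * (s * (s + 1)))) u =
      (((max (1 - u) 0) ^ 2 / (2 * u) : ℝ) : ℂ) := by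
  set f : ℝ → ℂ := indicator (Ioc 0 1) fun t : ℝ => ((1 : ℂ) - t) ^ 2 / (2 * t) with hf
  have hfu : ∀ v : ℝ, 0 < v → f v = (((max (1 - v) 0) ^ 2 / (2 * v) : ℝ) : ℂ) := by
    intro v hv
    by_cases h : v ≤ 1
    · rw [hf, indicator_of_mem (show v ∈ Ioc (0 : ℝ) 1 from ⟨hv, h⟩), max_eq_left (by linarith)]
      push_cast
      rfl
    · rw [hf, indicator_of_notMem (fun h' => h h'.2), max_eq_right (by linarith)]; simp
  have hmel : ∀ t : ℝ, mellin f ((2 : ℝ) + t * I) =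
      1 / (((2 : ℝ) + t * I - 1) * (((2 : ℝ) + t * I) * ((2 : ℝ) + t * I + 1))) := fun t =>
    (hasMellin_one_sub_sq_div_Ioc (by simp)).2
  have h := mellinInv_mellin_eq 2 f hu (hasMellin_one_sub_sq_div_Ioc (by simp)).1 ?_ ?_
  · rw [← hfu u hu, ← h]
    simp only [mellinInv, hmel]
  · refine verticalIntegrable_of_norm_le (C := 6) ?_ fun t => ?_
    · simp_rw [hmel]
      refine continuous_const.div (by fun_prop) fun t => mul_ne_zero ?_ (mul_ne_zero ?_ ?_)
      · exact sub_ne_zero.2 (add_mul_I_ne_of_re_lt (by norm_num))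
      · exact add_mul_I_ne_of_re_lt (by simp)
      · rw [Ne, add_eq_zero_iff_eq_neg]; exact add_mul_I_ne_of_re_lt (by norm_num)
    · rw [hmel, norm_div, norm_one, one_div, norm_mul, mul_inv]
      have h1 : 1 ≤ ‖((2 : ℝ) : ℂ) + t * I - 1‖ := by
        have h1 := Complex.abs_re_le_norm (((2 : ℝ) : ℂ) + t * Complex.I - 1)
        norm_num at h1
        simpa using h1
      exact (mul_le_of_le_one_left (by positivity) (inv_le_one_of_one_le₀ h1)).trans
        (norm_inv_mul_add_one_le (by norm_num))
  · have : ContinuousAt (fun v : ℝ => (((max (1 - v) 0) ^ 2 / (2 * v) : ℝ) : ℂ)) u := by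
      refine continuous_ofReal.continuousAt.comp ?_
      exact ContinuousAt.div (by fun_prop) (by fun_prop) (by positivity)
    refine this.congr ?_
    filter_upwards [lt_mem_nhds hu] with v hv using (hfu v hv).symm

/-! ### The Riesz kernel, contour shift, and differences of the kernel. -/

/-- The kernel `x ^ (s + 1) / (s (s + 1))` of the first Riesz mean. -/
noncomputable def rieszKernel (x : ℝ) (s : ℂ) : ℂ := (x : ℂ) ^ (s + 1) / (s * (s + 1))

theorem mul_eq_two_pi_mul_of_smul_eq (a : ℂ) {J v : ℂ} (h : (1 / (2 * Real.pi)) • J = v) :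
    a * J = 2 * Real.pi * (a * v) := by
  have : (Real.pi : ℂ) ≠ 0 := by exact_mod_cast Real.pi_ne_zero
  rw [← h, Complex.real_smul]
  push_cast
  field_simp

open MeasureTheory Complex Set in
theorem integral_cpow_neg_mul_rieszKernel {x n : ℝ} (hx : 0 < x) (hn : 0 < n) :
    ∫ t : ℝ, (n : ℂ) ^ (-(((2 : ℝ) : ℂ) + t * I)) * rieszKernel x (((2 : ℝ) : ℂ) + t * I) =
      2 * Real.pi * ((max (x - n) 0 : ℝ) : ℂ) := by
  have hx0 : (x : ℂ) ≠ 0 := by exact_mod_cast hx.ne'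
  have h := mellinInv_inv_mul_add_one (div_pos hn hx)
  have e : ∀ t : ℝ, (n : ℂ) ^ (-(((2 : ℝ) : ℂ) + t * I)) * rieszKernel x (((2 : ℝ) : ℂ) + t * I) =
      x * (((n / x : ℝ) : ℂ) ^ (-(((2 : ℝ) : ℂ) + t * I)) •
        (1 / ((((2 : ℝ) : ℂ) + t * I) * (((2 : ℝ) : ℂ) + t * I + 1)))) := by
    intro t
    rw [rieszKernel, div_eq_mul_inv n x, ofReal_mul, mul_cpow_ofReal_nonneg hn.le (by positivity),
      cpow_add _ _ hx0, cpow_one, ofReal_inv, inv_cpow _ _ (by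
        rw [arg_ofReal_of_nonneg hx.le]; exact Real.pi_pos.ne), cpow_neg (x : ℂ), inv_inv,
      smul_eq_mul]
    ring
  simp_rw [e, integral_const_mul]
  rw [mellinInv] at h
  have hm : max (x - n) 0 = x * max (1 - n / x) 0 := by
    rw [mul_max_of_nonneg _ _ hx.le, mul_zero]; congr 1; field_simp
  rw [hm, ofReal_mul]
  exact mul_eq_two_pi_mul_of_smul_eq _ h

-- The contribution of the pole in closed form, so that no residue at `s = 1` has to be taken.
open MeasureTheory Complex Set in
theorem integral_inv_sub_one_mul_rieszKernel {x : ℝ} (hx : 0 < x) :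
    ∫ t : ℝ, (((2 : ℝ) : ℂ) + t * I - 1)⁻¹ * rieszKernel x (((2 : ℝ) : ℂ) + t * I) =
      2 * Real.pi * (((max (x - 1) 0) ^ 2 / 2 : ℝ) : ℂ) := by
  have hx0 : (x : ℂ) ≠ 0 := by exact_mod_cast hx.ne'
  have h := mellinInv_inv_sub_one_mul (inv_pos.2 hx)
  have e : ∀ t : ℝ, (((2 : ℝ) : ℂ) + t * I - 1)⁻¹ * rieszKernel x (((2 : ℝ) : ℂ) + t * I) =
      x * (((x⁻¹ : ℝ) : ℂ) ^ (-(((2 : ℝ) : ℂ) + t * I)) •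
        (1 / ((((2 : ℝ) : ℂ) + t * I - 1) *
          ((((2 : ℝ) : ℂ) + t * I) * (((2 : ℝ) : ℂ) + t * I + 1))))) := by
    intro t
    rw [rieszKernel, cpow_add _ _ hx0, cpow_one, ofReal_inv, inv_cpow _ _ (by
        rw [arg_ofReal_of_nonneg hx.le]; exact Real.pi_pos.ne), cpow_neg (x : ℂ), inv_inv,
      smul_eq_mul, one_div, mul_inv]
    ring
  simp_rw [e, integral_const_mul]
  rw [mellinInv] at h
  have hm : (max (x - 1) 0) ^ 2 / 2 = x * ((max (1 - x⁻¹) 0) ^ 2 / (2 * x⁻¹)) := by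
    have : max (x - 1) 0 = x * max (1 - x⁻¹) 0 := by
      rw [mul_max_of_nonneg _ _ hx.le, mul_zero]; congr 1; field_simp
    rw [this]; field_simp
  rw [hm, ofReal_mul]
  exact mul_eq_two_pi_mul_of_smul_eq _ h

/-- Only the decay in `t` matters: this serves for integrability and for the contour shift, hence
the crude power of `x`. -/
theorem norm_rieszKernel_le {x σ t : ℝ} (hx : 1 ≤ x) (hσ : 1 / 2 ≤ σ) (hσ' : σ ≤ 2) :
    ‖rieszKernel x (σ + t * Complex.I)‖ ≤ 6 * x ^ (3 : ℝ) * (1 + |t|) ^ (-2 : ℝ) := by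
  rw [rieszKernel, norm_div, Complex.norm_cpow_eq_rpow_re_of_pos (by linarith), div_eq_mul_inv,
    mul_comm (6 : ℝ), mul_assoc]
  gcongr
  · simp; linarith
  · exact norm_inv_mul_add_one_le hσ

theorem differentiableOn_rieszKernel {x : ℝ} (hx : 0 < x) :
    DifferentiableOn ℂ (rieszKernel x) {s | 0 < s.re} := by
  intro s hs
  have h0 : s ≠ 0 := by rintro rfl; simp at hs
  have h1 : s + 1 ≠ 0 := by
    intro h; have := congrArg Complex.re h; simp at this hs; linarith
  refine DifferentiableAt.differentiableWithinAt ?_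
  refine DifferentiableAt.div ?_ (by fun_prop) (mul_ne_zero h0 h1)
  refine DifferentiableAt.const_cpow (by fun_prop) (Or.inl ?_)
  exact_mod_cast hx.ne'

theorem continuous_comp_verticalLine {g : ℂ → ℂ} (hg : ContinuousOn g {s | 0 < s.re})
    {σ : ℝ} (hσ : 0 < σ) : Continuous fun t : ℝ => g (σ + t * Complex.I) :=
  hg.comp_continuous (by fun_prop) fun t => by simpa using hσ

open MeasureTheory Complex Set in
theorem integrable_verticalLine {g : ℂ → ℂ} {C r σ : ℝ} (hr : 1 < r)
    (hg : ContinuousOn g {s | 0 < s.re}) (hσ : 0 < σ)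
    (hC : ∀ t : ℝ, ‖g (σ + t * I)‖ ≤ C * (1 + |t|) ^ (-r)) :
    Integrable fun t : ℝ => g (σ + t * I) :=
  ((integrable_one_add_abs_rpow hr).const_mul C).mono'
    (continuous_comp_verticalLine hg hσ).aestronglyMeasurable (Eventually.of_forall hC)

open MeasureTheory Complex Set in
/-- Shift of a vertical line of integration. -/
theorem integral_verticalLine_eq {g : ℂ → ℂ} {C r a b : ℝ} (hr : 1 < r) (ha : 0 < a) (hab : a ≤ b)
    (hg : DifferentiableOn ℂ g {s | 0 < s.re})
    (hC : ∀ σ ∈ Icc a b, ∀ t : ℝ, ‖g (σ + t * I)‖ ≤ C * (1 + |t|) ^ (-r)) :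
    ∫ t : ℝ, g (a + t * I) = ∫ t : ℝ, g (b + t * I) := by
  have hia := integrable_verticalLine hr hg.continuousOn ha (hC a ⟨le_rfl, hab⟩)
  have hib := integrable_verticalLine hr hg.continuousOn (ha.trans_le hab) (hC b ⟨hab, le_rfl⟩)
  have hta := intervalIntegral_tendsto_integral hia tendsto_neg_atTop_atBot tendsto_id
  have htb := intervalIntegral_tendsto_integral hib tendsto_neg_atTop_atBot tendsto_id
  have hdec : Tendsto (fun T : ℝ => (1 + |T|) ^ (-r)) atTop (nhds 0) := by
    refine (tendsto_rpow_neg_atTop (by linarith)).comp ?_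
    exact tendsto_atTop_add_const_left _ _ tendsto_abs_atTop_atTop
  -- The horizontal sides of the rectangle, at heights `T` and `-T`, vanish in the limit.
  have hhor : ∀ e : ℝ, e = 1 ∨ e = -1 →
      Tendsto (fun T : ℝ => ∫ σ in a..b, g (σ + (e * T : ℝ) * I)) atTop (nhds 0) := by
    intro e he
    refine squeeze_zero_norm (a := fun T : ℝ => C * (1 + |T|) ^ (-r) * |b - a|) (fun T => ?_) ?_
    · refine intervalIntegral.norm_integral_le_of_norm_le_const fun σ hσ => ?_
      rw [uIoc_of_le hab] at hσ
      have := hC σ ⟨hσ.1.le, hσ.2⟩ (e * T)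
      rwa [show |e * T| = |T| by rcases he with rfl | rfl <;> simp] at this
    · simpa using (hdec.const_mul C).mul_const |b - a|
  have hrect : ∀ T : ℝ, I • (∫ t in (-T)..(id T), g (b + t * I)) -
      I • (∫ t in (-T)..(id T), g (a + t * I)) =
      (∫ σ in a..b, g (σ + (1 * T : ℝ) * I)) - ∫ σ in a..b, g (σ + (-1 * T : ℝ) * I) := by
    intro T
    have h := integral_boundary_rect_eq_zero_of_differentiableOn g (a + (-T : ℝ) * I)
      (b + (T : ℝ) * I)
      (hg.mono fun s hs => ?_)
    · simp only [add_re, ofReal_re, mul_re, I_re, mul_zero, ofReal_im, I_im, mul_one, sub_self,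
        add_zero, add_im, mul_im, zero_add] at h
      simp only [id, one_mul, neg_one_mul]
      linear_combination h
    · have := hs.1
      simp [uIcc_of_le hab] at this
      exact ha.trans_le this.1
  have hlim := (htb.const_smul I).sub (hta.const_smul I)
  have hlim2 := (hhor 1 (Or.inl rfl)).sub (hhor (-1) (Or.inr rfl))
  have := tendsto_nhds_unique (hlim.congr hrect) hlim2
  rw [sub_zero, sub_eq_zero] at this
  exact (smul_right_injective ℂ I_ne_zero this).symm

/-- Interpolation between the mean value bound `‖s+1‖ (x+1)^σ` and the trivial bound `2
(x+1)^(σ+1)`, with weights `1-δ` and `δ`. The gain of `‖s+1‖^(-δ)` over the first makes the integral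
converge; it costs only `(x+1)^δ`. -/
theorem norm_cpow_add_one_sub_cpow_le {x σ δ : ℝ} {s : ℂ} (hx : 0 < x) (hs : s.re = σ)
    (hσ : 0 ≤ σ) (hδ : 0 ≤ δ) (hδ' : δ ≤ 1) :
    ‖((x + 1 : ℝ) : ℂ) ^ (s + 1) - (x : ℂ) ^ (s + 1)‖ ≤
      2 * ‖s + 1‖ ^ (1 - δ) * (x + 1) ^ (σ + δ) := by
  set N := ‖((x + 1 : ℝ) : ℂ) ^ (s + 1) - (x : ℂ) ^ (s + 1)‖ with hN
  have hN0 : 0 ≤ N := norm_nonneg _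
  have hs1 : s + 1 ≠ 0 := by
    intro h; have := congrArg Complex.re h; simp at this; linarith
  have h1 : N ≤ ‖s + 1‖ * (x + 1) ^ σ := by
    have h := Convex.norm_image_sub_le_of_norm_hasDerivWithin_le
      (f := fun u : ℝ => (u : ℂ) ^ (s + 1)) (f' := fun u : ℝ => (s + 1) * (u : ℂ) ^ s)
      (C := ‖s + 1‖ * (x + 1) ^ σ) (s := Set.Icc x (x + 1)) (x := x) (y := x + 1) ?_ ?_
      (convex_Icc _ _) ⟨le_rfl, by linarith⟩ ⟨by linarith, le_rfl⟩
    · simpa [hN] using h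
    · intro u hu
      have := hasDerivAt_ofReal_cpow_const' (x := u) (by linarith [hu.1]) (r := s) ?_
      · have h2 := (this.const_mul (s + 1)).hasDerivWithinAt (s := Set.Icc x (x + 1))
        simpa [mul_div_cancel₀ _ hs1] using h2
      · intro h; rw [h] at hs1; simp at hs1
    · intro u hu
      rw [norm_mul, Complex.norm_cpow_eq_rpow_re_of_pos (by linarith [hu.1]), hs]
      gcongr
      · linarith [hu.1]
      · exact hu.2
  have h2 : N ≤ 2 * (x + 1) ^ (σ + 1) := by
    refine (norm_sub_le _ _).trans ?_
    rw [Complex.norm_cpow_eq_rpow_re_of_pos (by linarith), Complex.norm_cpow_eq_rpow_re_of_pos hx]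
    simp only [Complex.add_re, hs, Complex.one_re, two_mul]
    gcongr
    linarith
  have hp : 0 < x + 1 := by linarith
  calc N = N ^ (1 - δ) * N ^ δ := by
        rcases hN0.eq_or_lt with h | h
        · rw [← h]
          rcases eq_or_ne δ 0 with rfl | h'
          · simp
          · simp [Real.zero_rpow h']
        · rw [← Real.rpow_add h]; simp
    _ ≤ (‖s + 1‖ * (x + 1) ^ σ) ^ (1 - δ) * (2 * (x + 1) ^ (σ + 1)) ^ δ := by
        gcongr
    _ = 2 ^ δ * (‖s + 1‖ ^ (1 - δ) * (x + 1) ^ (σ + δ)) := by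
        rw [Real.mul_rpow (by positivity) (by positivity),
          Real.mul_rpow (by positivity) (by positivity), ← Real.rpow_mul hp.le,
          ← Real.rpow_mul hp.le, show σ + δ = σ * (1 - δ) + (σ + 1) * δ by ring,
          Real.rpow_add hp]
        ring
    _ ≤ 2 * (‖s + 1‖ ^ (1 - δ) * (x + 1) ^ (σ + δ)) := by
        gcongr
        calc (2 : ℝ) ^ δ ≤ 2 ^ (1 : ℝ) := Real.rpow_le_rpow_of_exponent_le one_le_two hδ'
          _ = 2 := Real.rpow_one 2
    _ = _ := by ring

/-! ### From a Dirichlet series to its counting function. -/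

-- Perron's formula for the Riesz mean: on `Re s = 2` both `∑ ν^(-2)` and the kernel converge
-- absolutely, so sum and integral may be exchanged.
open MeasureTheory Complex Set in
theorem hasSum_max_sub_zero {ι : Type*} {ν : ι → ℝ} (hν : ∀ i, 0 < ν i)
    (hsum : Summable fun i => ν i ^ (-2 : ℝ)) {G : ℂ → ℂ}
    (hG : ∀ t : ℝ, HasSum (fun i => (ν i : ℂ) ^ (-(((2 : ℝ) : ℂ) + t * I)))
      (G (((2 : ℝ) : ℂ) + t * I))) {x : ℝ} (hx : 1 ≤ x) :
    HasSum (fun i => ((max (x - ν i) 0 : ℝ) : ℂ)) ((2 * Real.pi : ℂ)⁻¹ *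
      ∫ t : ℝ, G (((2 : ℝ) : ℂ) + t * I) * rieszKernel x (((2 : ℝ) : ℂ) + t * I)) := by
  have hπ : (2 * Real.pi : ℂ) ≠ 0 := by simp
  -- The exchange requires a countable index set; a summable family has countable support, and here
  -- no term vanishes.
  have hcount : Countable ι := by
    have h := hsum.countable_support
    rwa [Function.support_eq_univ fun i => (Real.rpow_pos_of_pos (hν i) _).ne',
      countable_univ_iff] at h
  have hx0 : 0 < x := by linarith
  have hR : Integrable fun t : ℝ => rieszKernel x (((2 : ℝ) : ℂ) + t * I) :=
    integrable_verticalLine one_lt_two (differentiableOn_rieszKernel hx0).continuousOn two_pos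
      fun t => norm_rieszKernel_le hx (by norm_num) le_rfl
  have hnorm : ∀ i (t : ℝ), ‖(ν i : ℂ) ^ (-(((2 : ℝ) : ℂ) + t * I))‖ = ν i ^ (-2 : ℝ) := by
    intro i t
    rw [norm_cpow_eq_rpow_re_of_pos (hν i)]
    simp
  have h := hasSum_integral_of_summable_integral_norm (μ := volume)
    (F := fun i (t : ℝ) => (ν i : ℂ) ^ (-(((2 : ℝ) : ℂ) + t * I)) *
      rieszKernel x (((2 : ℝ) : ℂ) + t * I)) ?_ ?_
  · simp_rw [tsum_mul_right, (hG _).tsum_eq, integral_cpow_neg_mul_rieszKernel hx0 (hν _)] at h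
    have := h.mul_left (2 * Real.pi : ℂ)⁻¹
    simpa only [inv_mul_cancel_left₀ hπ] using this
  · intro i
    refine hR.bdd_mul (c := ν i ^ (-2 : ℝ)) ?_ (Eventually.of_forall fun t => (hnorm i t).le)
    refine Continuous.aestronglyMeasurable ?_
    refine Continuous.const_cpow (by fun_prop) (Or.inl ?_)
    exact_mod_cast (hν i).ne'
  · simp_rw [norm_mul, hnorm, integral_const_mul]
    exact hsum.mul_right _

-- Only the entire part `F` is moved to `Re s = 1/2`; the polar part is evaluated on `Re s = 2` and
-- gives `c (x-1)²/2`.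
open MeasureTheory Complex Set in
theorem hasSum_max_sub_zero_shift {ι : Type*} {ν : ι → ℝ} (hν : ∀ i, 0 < ν i)
    (hsum : Summable fun i => ν i ^ (-2 : ℝ)) {F : ℂ → ℂ} {c C η : ℝ}
    (hG : ∀ t : ℝ, HasSum (fun i => (ν i : ℂ) ^ (-(((2 : ℝ) : ℂ) + t * I)))
      (F (((2 : ℝ) : ℂ) + t * I) + c * (((2 : ℝ) : ℂ) + t * I - 1)⁻¹))
    (hF : Differentiable ℂ F) (hη : η < 1)
    (hC : ∀ σ ∈ Icc (1 / 2 : ℝ) 2, ∀ t : ℝ, ‖F (σ + t * I)‖ ≤ C * (1 + |t|) ^ η)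
    {x : ℝ} (hx : 1 ≤ x) :
    HasSum (fun i => ((max (x - ν i) 0 : ℝ) : ℂ)) ((2 * Real.pi : ℂ)⁻¹ *
      (∫ t : ℝ, F (((1 / 2 : ℝ) : ℂ) + t * I) * rieszKernel x (((1 / 2 : ℝ) : ℂ) + t * I)) +
        ((c * ((x - 1) ^ 2 / 2) : ℝ) : ℂ)) := by
  have hx0 : 0 < x := by linarith
  have hC0 : 0 ≤ C := by
    have := hC 2 ⟨by norm_num, le_rfl⟩ 0
    simp only [abs_zero, add_zero, Real.one_rpow, mul_one] at this
    exact (norm_nonneg _).trans this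
  have hdiff : DifferentiableOn ℂ (fun s => F s * rieszKernel x s) {s | 0 < s.re} :=
    hF.differentiableOn.mul (differentiableOn_rieszKernel hx0)
  have hb : ∀ σ ∈ Icc (1 / 2 : ℝ) 2, ∀ t : ℝ, ‖F (σ + t * I) * rieszKernel x (σ + t * I)‖ ≤
      C * (6 * x ^ (3 : ℝ)) * (1 + |t|) ^ (-(2 - η)) := by
    intro σ hσ t
    rw [norm_mul, show -(2 - η) = η + -2 by ring, Real.rpow_add (by positivity)]
    calc _ ≤ (C * (1 + |t|) ^ η) * (6 * x ^ (3 : ℝ) * (1 + |t|) ^ (-2 : ℝ)) := by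
          gcongr
          · exact hC σ hσ t
          · exact norm_rieszKernel_le hx hσ.1 hσ.2
      _ = _ := by ring
  have h1 : (1 : ℝ) < 2 - η := by linarith
  rw [integral_verticalLine_eq (g := fun s => F s * rieszKernel x s) h1 (by norm_num)
    (by norm_num) hdiff hb]
  convert! hasSum_max_sub_zero hν hsum (G := fun s => F s + c * (s - 1)⁻¹) hG hx using 1
  have hi1 := integrable_verticalLine (g := fun s => F s * rieszKernel x s) h1 hdiff.continuousOn
    two_pos (hb 2 ⟨by norm_num, le_rfl⟩)
  have hi2 : Integrable fun t : ℝ =>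
      (((2 : ℝ) : ℂ) + t * I - 1)⁻¹ * rieszKernel x (((2 : ℝ) : ℂ) + t * I) := by
    have hne : ∀ t : ℝ, ((2 : ℝ) : ℂ) + t * I - 1 ≠ 0 := fun t =>
      sub_ne_zero.2 (add_mul_I_ne_of_re_lt (by norm_num))
    refine Integrable.bdd_mul (c := 1) (integrable_verticalLine one_lt_two
      (differentiableOn_rieszKernel hx0).continuousOn two_pos
      fun t => norm_rieszKernel_le hx (by norm_num) le_rfl) ?_ (Eventually.of_forall fun t => ?_)
    · exact (Continuous.inv₀ (by fun_prop) hne).aestronglyMeasurable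
    · rw [norm_inv]
      refine inv_le_one_of_one_le₀ ?_
      have h1 := Complex.abs_re_le_norm (((2 : ℝ) : ℂ) + t * Complex.I - 1)
      norm_num at h1
      simpa using h1
  simp_rw [add_mul, mul_assoc]
  rw [integral_add hi1 (hi2.const_mul _), integral_const_mul,
    integral_inv_sub_one_mul_rieszKernel hx0, max_eq_left (by linarith)]
  have : (Real.pi : ℂ) ≠ 0 := by exact_mod_cast Real.pi_ne_zero
  rw [mul_add]
  congr 1
  push_cast
  field_simp

-- The integrand is `O((1+|t|)^(η-1-δ))`, integrable since `η < δ`.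
open MeasureTheory Complex Set in
theorem norm_integral_mul_rieszKernel_sub_le {F : ℂ → ℂ} {C η δ : ℝ} (hηδ : η < δ)
    (hδ : 0 ≤ δ) (hδ' : δ ≤ 1) (hC0 : 0 ≤ C)
    (hC : ∀ t : ℝ, ‖F (((1 / 2 : ℝ) : ℂ) + t * I)‖ ≤ C * (1 + |t|) ^ η) {x : ℝ} (hx : 0 < x) :
    ‖∫ t : ℝ, F (((1 / 2 : ℝ) : ℂ) + t * I) * (rieszKernel (x + 1) (((1 / 2 : ℝ) : ℂ) + t * I) -
      rieszKernel x (((1 / 2 : ℝ) : ℂ) + t * I))‖ ≤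
      (12 * C * ∫ t : ℝ, (1 + |t|) ^ (-(1 + δ - η))) * (x + 1) ^ (1 / 2 + δ) := by
  rw [mul_right_comm, ← integral_const_mul]
  refine norm_integral_le_of_norm_le
    ((integrable_one_add_abs_rpow (by linarith)).const_mul _) (Eventually.of_forall fun t => ?_)
  set s : ℂ := ((1 / 2 : ℝ) : ℂ) + t * I with hs
  have hsre : s.re = 1 / 2 := by simp [hs]
  have hp : 0 < 1 + |t| := by positivity
  have hs0 : 0 < ‖s‖ := by
    have := one_add_abs_le_norm (σ := 1 / 2) (t := t) le_rfl
    rw [← hs] at this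
    linarith
  have h2 := one_add_abs_le_norm_add_one (σ := 1 / 2) (t := t) le_rfl
  rw [← hs] at h2
  have hs1 : 0 < ‖s + 1‖ := by linarith
  have hk : ‖rieszKernel (x + 1) s - rieszKernel x s‖ ≤
      12 * (1 + |t|) ^ (-(1 + δ)) * (x + 1) ^ (1 / 2 + δ) := by
    rw [rieszKernel, rieszKernel, ← sub_div, norm_div, norm_mul]
    have h := norm_cpow_add_one_sub_cpow_le (s := s) hx hsre (by norm_num) hδ hδ'
    have h1 := one_add_abs_le_norm (σ := 1 / 2) (t := t) le_rfl
    rw [← hs] at h1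
    have hA : ‖s + 1‖ ^ (1 - δ) / (‖s‖ * ‖s + 1‖) ≤ 6 * (1 + |t|) ^ (-(1 + δ)) := by
      have e1 : ‖s + 1‖ ^ (1 - δ) / (‖s‖ * ‖s + 1‖) = ‖s‖⁻¹ * ‖s + 1‖ ^ (-δ) := by
        rw [sub_eq_add_neg, Real.rpow_add hs1, Real.rpow_one]
        field_simp
      have e2 : ‖s‖⁻¹ ≤ 3 * (1 + |t|)⁻¹ := by
        rw [← div_eq_mul_inv, le_div_iff₀ hp, inv_mul_le_iff₀ hs0]
        linarith
      have e3 : ‖s + 1‖ ^ (-δ) ≤ 2 * (1 + |t|) ^ (-δ) := by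
        calc ‖s + 1‖ ^ (-δ) ≤ ((1 + |t|) / 2) ^ (-δ) :=
              Real.rpow_le_rpow_of_nonpos (by positivity) (by linarith) (by linarith)
          _ = 2 ^ δ * (1 + |t|) ^ (-δ) := by
              rw [Real.div_rpow hp.le zero_le_two, Real.rpow_neg zero_le_two, div_inv_eq_mul,
                mul_comm]
          _ ≤ 2 ^ (1 : ℝ) * (1 + |t|) ^ (-δ) := by
              gcongr
              exact one_le_two
          _ = _ := by rw [Real.rpow_one]
      rw [e1, neg_add, Real.rpow_add hp, Real.rpow_neg_one]
      calc _ ≤ (3 * (1 + |t|)⁻¹) * (2 * (1 + |t|) ^ (-δ)) := by gcongr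
        _ = _ := by ring
    calc _ ≤ 2 * ‖s + 1‖ ^ (1 - δ) * (x + 1) ^ (1 / 2 + δ) / (‖s‖ * ‖s + 1‖) := by gcongr
      _ = 2 * (‖s + 1‖ ^ (1 - δ) / (‖s‖ * ‖s + 1‖)) * (x + 1) ^ (1 / 2 + δ) := by ring
      _ ≤ 2 * (6 * (1 + |t|) ^ (-(1 + δ))) * (x + 1) ^ (1 / 2 + δ) := by gcongr
      _ = _ := by ring
  rw [norm_mul, show -(1 + δ - η) = η + -(1 + δ) by ring, Real.rpow_add hp]
  calc _ ≤ (C * (1 + |t|) ^ η) * (12 * (1 + |t|) ^ (-(1 + δ)) * (x + 1) ^ (1 / 2 + δ)) := by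
        gcongr
        exact hC t
    _ = _ := by ring

open MeasureTheory Complex Set in
theorem hasSum_max_sub_max_sub {ι : Type*} {ν : ι → ℝ} (hν : ∀ i, 0 < ν i)
    (hsum : Summable fun i => ν i ^ (-2 : ℝ)) {F : ℂ → ℂ} {c C η δ : ℝ}
    (hG : ∀ t : ℝ, HasSum (fun i => (ν i : ℂ) ^ (-(((2 : ℝ) : ℂ) + t * I)))
      (F (((2 : ℝ) : ℂ) + t * I) + c * (((2 : ℝ) : ℂ) + t * I - 1)⁻¹))
    (hF : Differentiable ℂ F) (hηδ : η < δ) (hδ : 0 ≤ δ) (hδ' : δ ≤ 1)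
    (hC : ∀ σ ∈ Icc (1 / 2 : ℝ) 2, ∀ t : ℝ, ‖F (σ + t * I)‖ ≤ C * (1 + |t|) ^ η) :
    ∃ B : ℝ, 0 ≤ B ∧ ∀ x : ℝ, 1 ≤ x → ∃ D : ℝ,
      HasSum (fun i => max (x + 1 - ν i) 0 - max (x - ν i) 0) D ∧
      |D - c * x| ≤ B * (x + 1) ^ (1 / 2 + δ) := by
  have hC0 : 0 ≤ C := by
    have := hC 2 ⟨by norm_num, le_rfl⟩ 0
    simp only [abs_zero, add_zero, Real.one_rpow, mul_one] at this
    exact (norm_nonneg _).trans this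
  set M : ℝ := 12 * C * ∫ t : ℝ, (1 + |t|) ^ (-(1 + δ - η)) with hM
  have hM0 : 0 ≤ M := mul_nonneg (by positivity) (integral_nonneg fun t => by positivity)
  refine ⟨(2 * Real.pi)⁻¹ * M + |c|, by positivity, fun x hx => ?_⟩
  have h1 := hasSum_max_sub_zero_shift hν hsum hG hF (by linarith) hC hx
  have h2 := hasSum_max_sub_zero_shift hν hsum hG hF (by linarith) hC (x := x + 1) (by linarith)
  have h := h2.sub h1
  have hi : ∀ y : ℝ, 1 ≤ y → Integrable fun t : ℝ =>
      F (((1 / 2 : ℝ) : ℂ) + t * I) * rieszKernel y (((1 / 2 : ℝ) : ℂ) + t * I) := by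
    intro y hy
    have hdiff : DifferentiableOn ℂ (fun s => F s * rieszKernel y s) {s | 0 < s.re} :=
      hF.differentiableOn.mul (differentiableOn_rieszKernel (by linarith))
    refine integrable_verticalLine (g := fun s => F s * rieszKernel y s) (r := 2 - η)
      (C := C * (6 * y ^ (3 : ℝ))) (by linarith) hdiff.continuousOn (by norm_num) fun t => ?_
    rw [norm_mul, show -(2 - η) = η + -2 by ring, Real.rpow_add (by positivity)]
    calc _ ≤ (C * (1 + |t|) ^ η) * (6 * y ^ (3 : ℝ) * (1 + |t|) ^ (-2 : ℝ)) := by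
          gcongr
          · exact hC _ ⟨le_rfl, by norm_num⟩ t
          · exact norm_rieszKernel_le hy le_rfl (by norm_num)
      _ = _ := by ring
  have hb := norm_integral_mul_rieszKernel_sub_le (x := x) hηδ hδ hδ' hC0
    (hC (1 / 2) ⟨le_rfl, by norm_num⟩) (by linarith)
  simp_rw [mul_sub] at hb
  rw [integral_sub (hi _ (by linarith)) (hi _ hx), ← hM] at hb
  set J := (∫ t : ℝ, F (((1 / 2 : ℝ) : ℂ) + t * I) *
    rieszKernel (x + 1) (((1 / 2 : ℝ) : ℂ) + t * I)) - ∫ t : ℝ, F (((1 / 2 : ℝ) : ℂ) + t * I) *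
    rieszKernel x (((1 / 2 : ℝ) : ℂ) + t * I) with hJ
  have h' : HasSum (fun i => ((max (x + 1 - ν i) 0 - max (x - ν i) 0 : ℝ) : ℂ))
      ((2 * Real.pi : ℂ)⁻¹ * J + ((c * (x - 1 / 2) : ℝ) : ℂ)) := by
    convert! h using 1
    · ext i; push_cast; rfl
    · rw [hJ]; push_cast; ring
  refine ⟨((2 * Real.pi : ℂ)⁻¹ * J + ((c * (x - 1 / 2) : ℝ) : ℂ)).re, hasSum_re h', ?_⟩
  -- The main terms differ by `c (x² - (x-1)²)/2 = c (x - 1/2)`; the leftover `-c/2` goes into the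
  -- summand `|c|` of the bound.
  rw [add_re, ofReal_re, show ((2 * Real.pi : ℂ)⁻¹ * J).re + c * (x - 1 / 2) - c * x =
    ((2 * Real.pi : ℂ)⁻¹ * J).re + -(c / 2) by ring, add_mul]
  refine (abs_add_le _ _).trans (add_le_add ?_ ?_)
  · refine (abs_re_le_norm _).trans ?_
    rw [norm_mul, mul_assoc]
    gcongr
    rw [norm_inv]
    simp [abs_of_pos Real.pi_pos]
  · have : (1 : ℝ) ≤ (x + 1) ^ (1 / 2 + δ) := Real.one_le_rpow (by linarith) (by linarith)
    rw [abs_neg, abs_div, abs_two]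
    nlinarith [abs_nonneg c]

open Set in
theorem hasSum_ncard_setOf_le {ι : Type*} {ν : ι → ℝ} {x : ℝ} (hfin : {i | ν i ≤ x}.Finite) :
    HasSum ({i | ν i ≤ x}.indicator fun _ => (1 : ℝ)) {i | ν i ≤ x}.ncard := by
  have h := hasSum_sum_of_ne_finset_zero (L := .unconditional ι)
    (f := {i | ν i ≤ x}.indicator fun _ => (1 : ℝ)) (s := hfin.toFinset)
    (fun i hi => indicator_of_notMem (by simpa using hi) _)
  convert h using 1
  rw [Finset.sum_congr rfl (fun i hi => indicator_of_mem (by simpa using hi) _),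
    ncard_eq_toFinset_card _ hfin]
  simp

-- Monotonicity replaces a sharp Perron formula: `max (x+1-ν) 0 - max (x-ν) 0` is 1 for `ν ≤ x`, 0
-- for `ν ≥ x+1`, and in between otherwise, so unit differences of the Riesz mean at `x` and at
-- `x-1` enclose the count.
open Complex Set in
theorem exists_abs_ncard_sub_le {ι : Type*} {ν : ι → ℝ} (hν : ∀ i, 0 < ν i)
    (hfin : ∀ x, {i | ν i ≤ x}.Finite)
    (hsum : Summable fun i => ν i ^ (-2 : ℝ)) {F : ℂ → ℂ} {c C η δ : ℝ} (hc : 0 ≤ c)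
    (hG : ∀ t : ℝ, HasSum (fun i => (ν i : ℂ) ^ (-(((2 : ℝ) : ℂ) + t * I)))
      (F (((2 : ℝ) : ℂ) + t * I) + c * (((2 : ℝ) : ℂ) + t * I - 1)⁻¹))
    (hF : Differentiable ℂ F) (hηδ : η < δ) (hδ : 0 ≤ δ) (hδ' : δ ≤ 1)
    (hC : ∀ σ ∈ Icc (1 / 2 : ℝ) 2, ∀ t : ℝ, ‖F (σ + t * I)‖ ≤ C * (1 + |t|) ^ η) :
    ∃ B : ℝ, 0 ≤ B ∧ ∀ x : ℝ, 1 ≤ x →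
      |({i | ν i ≤ x}.ncard : ℝ) - c * x| ≤ B * x ^ (1 / 2 + δ) := by
  obtain ⟨B, hB, h⟩ := hasSum_max_sub_max_sub hν hsum hG hF hηδ hδ hδ' hC
  refine ⟨B * 2 ^ (1 / 2 + δ) + 2 * c, by positivity, fun x hx => ?_⟩
  have hx1 : (1 : ℝ) ≤ x ^ (1 / 2 + δ) := Real.one_le_rpow (by linarith) (by linarith)
  have hN := hasSum_ncard_setOf_le (hfin x)
  rw [abs_le]
  constructor
  -- The difference at `x-1` is available only for `x-1 ≥ 1`; for smaller `x`, `c x ≤ 2c` suffices.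
  · by_cases hx2 : x ≤ 2
    · have h1 : 0 ≤ B * 2 ^ (1 / 2 + δ) := by positivity
      nlinarith [Nat.cast_nonneg (α := ℝ) {i | ν i ≤ x}.ncard, mul_nonneg hc (sub_nonneg.2 hx1)]
    · obtain ⟨D, hD, hD'⟩ := h (x - 1) (by linarith)
      have hle : D ≤ ({i | ν i ≤ x}.ncard : ℝ) := by
        refine hasSum_le (fun i => ?_) hD hN
        by_cases hi : ν i ≤ x
        · rw [indicator_of_mem (show i ∈ {i | ν i ≤ x} from hi)]
          have h1 := le_max_left (x - 1 - ν i) 0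
          have h2 := le_max_right (x - 1 - ν i) 0
          have h3 : max (x - 1 + 1 - ν i) 0 ≤ max (x - 1 - ν i) 0 + 1 :=
            max_le (by linarith) (by linarith)
          linarith
        · rw [indicator_of_notMem (show i ∉ {i | ν i ≤ x} from hi), max_eq_right (by linarith),
            max_eq_right (by linarith), sub_self]
      have h1 := (abs_le.1 hD').1
      have h2 : B * (x - 1 + 1) ^ (1 / 2 + δ) ≤ B * 2 ^ (1 / 2 + δ) * x ^ (1 / 2 + δ) := by
        rw [sub_add_cancel, mul_right_comm]
        exact le_mul_of_one_le_right (by positivity) (Real.one_le_rpow one_le_two (by linarith))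
      nlinarith [mul_nonneg hc (sub_nonneg.2 hx1)]
  · obtain ⟨D, hD, hD'⟩ := h x hx
    have hle : ({i | ν i ≤ x}.ncard : ℝ) ≤ D := by
      refine hasSum_le (fun i => ?_) hN hD
      by_cases hi : ν i ≤ x
      · rw [indicator_of_mem (show i ∈ {i | ν i ≤ x} from hi), max_eq_left (by linarith),
          max_eq_left (by linarith)]
        linarith
      · rw [indicator_of_notMem (show i ∉ {i | ν i ≤ x} from hi), sub_nonneg]
        exact max_le_max (by linarith) le_rfl
    have h1 := (abs_le.1 hD').2
    have h2 : B * (x + 1) ^ (1 / 2 + δ) ≤ B * 2 ^ (1 / 2 + δ) * x ^ (1 / 2 + δ) := by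
      rw [mul_assoc, ← Real.mul_rpow (by norm_num) (by linarith)]
      gcongr
      linarith
    nlinarith [mul_nonneg hc (sub_nonneg.2 hx1)]

/-! ### The entire part of the zeta function and its growth. -/

-- A meromorphic function either tends to infinity at `z` or has a finite limit there, so a limit
-- along any approach to `z` decides. The residue of `ζ_K` is known only along real `s → 1⁺`.
open Topology in
theorem MeromorphicAt.tendsto_of_tendsto_of_neBot {f : ℂ → ℂ} {z c : ℂ} (hf : MeromorphicAt f z)
    {l : Filter ℂ} [l.NeBot] (hl : l ≤ 𝓝[≠] z) (h : Tendsto f l (𝓝 c)) :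
    Tendsto f (𝓝[≠] z) (𝓝 c) := by
  rcases lt_or_ge (meromorphicOrderAt f z) 0 with h0 | h0
  · have h1 := ((tendsto_cobounded_iff_meromorphicOrderAt_neg hf).2 h0).mono_left hl
    exact absurd (tendsto_norm_atTop_iff_cobounded.2 h1) (not_tendsto_atTop_of_tendsto_nhds h.norm)
  · obtain ⟨a, ha⟩ := (tendsto_nhds_iff_meromorphicOrderAt_nonneg hf).2 h0
    rwa [tendsto_nhds_unique h (ha.mono_left hl)]

open Topology in
theorem IsDedekindZetaContinuation.tendsto_sub_one_mul {K : Type*} [Field K] [NumberField K]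
    {Z : ℂ → ℂ} (hZ : IsDedekindZetaContinuation K Z) :
    Tendsto (fun s => (s - 1) * Z s) (𝓝[≠] 1) (𝓝 (dedekindZeta_residue K)) := by
  have hm : MeromorphicAt (fun s => (s - 1) * Z s) 1 :=
    (by fun_prop : MeromorphicAt (fun s : ℂ => s - 1) 1).mul hZ.meromorphicAt_one
  refine hm.tendsto_of_tendsto_of_neBot (l := (𝓝[>] (1 : ℝ)).map ((↑) : ℝ → ℂ)) ?_ ?_
  · rw [← Filter.Tendsto]
    refine tendsto_nhdsWithin_iff.2 ⟨?_, ?_⟩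
    · exact (Complex.continuous_ofReal.tendsto' 1 1 (by simp)).mono_left nhdsWithin_le_nhds
    · filter_upwards [self_mem_nhdsWithin] with s hs
      have : s ≠ 1 := (Set.mem_Ioi.1 hs).ne'
      simpa using this
  · rw [tendsto_map'_iff]
    refine (tendsto_sub_one_mul_dedekindZeta_nhdsGT K).congr' ?_
    filter_upwards [self_mem_nhdsWithin] with s hs
    simp only [Function.comp]
    rw [hZ.eq_dedekindZeta s (by simpa using hs)]

open Topology in
theorem IsDedekindZetaContinuation.exists_differentiable {K : Type*} [Field K] [NumberField K]
    {Z : ℂ → ℂ} (hZ : IsDedekindZetaContinuation K Z) :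
    ∃ F : ℂ → ℂ, Differentiable ℂ F ∧
      ∀ s, s ≠ 1 → F s = Z s - dedekindZeta_residue K * (s - 1)⁻¹ := by
  have hlim := hZ.tendsto_sub_one_mul
  set c : ℂ := (dedekindZeta_residue K : ℂ)
  set h : ℂ → ℂ := Function.update (fun s => (s - 1) * Z s) 1 c with hh
  have hne : ∀ s, s ≠ 1 → h s = (s - 1) * Z s := fun s hs => Function.update_of_ne hs _ _
  have hd : DifferentiableOn ℂ h {1}ᶜ := by
    refine (DifferentiableOn.mul (by fun_prop) hZ.differentiableOn).congr fun s hs => hne s hs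
  have hcont : ContinuousAt h 1 := continuousAt_update_same.2 hlim
  have hdiff : Differentiable ℂ h := by
    have := (Complex.differentiableOn_compl_singleton_and_continuousAt_iff
      (s := Set.univ) (f := h) (c := 1) univ_mem).1 ⟨by rwa [← Set.compl_eq_univ_sdiff], hcont⟩
    exact differentiableOn_univ.1 this
  -- `h` is `(s-1) Z(s)` with the singularity removed, so its difference quotient at 1 is `Z(s) -
  -- c/(s-1)`.
  refine ⟨dslope h 1, ?_, fun s hs => ?_⟩
  · exact differentiableOn_univ.1
      ((Complex.differentiableOn_dslope univ_mem).2 hdiff.differentiableOn)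
  · have hs' : s - 1 ≠ 0 := sub_ne_zero.2 hs
    rw [dslope_of_ne _ hs, slope_def_field, hne s hs, show h 1 = c from Function.update_self ..]
    field_simp

-- The hypothesis bounds `ζ_K` only as `t → +∞`; this symmetry, carried to `F` by the identity
-- theorem, covers `t → -∞`.
open ComplexConjugate in
theorem dedekindZeta_conj (K : Type*) [Field K] [NumberField K] {s : ℂ} (hs : 1 < s.re) :
    dedekindZeta K (conj s) = conj (dedekindZeta K s) := by
  have h1 := hasSum_absNorm_cpow K (s := conj s) (by simpa)
  have h2 := (Complex.hasSum_conj').2 (hasSum_absNorm_cpow K hs)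
  refine h1.unique ?_
  convert h2 using 2 with I
  rw [← map_neg, Complex.cpow_conj _ _ (by simpa using Real.pi_pos.ne), Complex.conj_natCast]

open ComplexConjugate Topology in
theorem eq_conj_of_differentiable {F : ℂ → ℂ} (hF : Differentiable ℂ F)
    (h : ∀ s : ℂ, 1 < s.re → F (conj s) = conj (F s)) (s : ℂ) : F (conj s) = conj (F s) := by
  have hG : Differentiable ℂ fun s => conj (F (conj s)) := fun s =>
    differentiableAt_conj_conj_iff.2 (hF (conj s))
  have h2 : {s : ℂ | 1 < s.re} ∈ 𝓝 (2 : ℂ) :=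
    (isOpen_lt continuous_const Complex.continuous_re).mem_nhds (by simp)
  have := AnalyticOnNhd.eq_of_eventuallyEq (z₀ := 2)
    (fun z _ => hF.analyticAt z) (fun z _ => hG.analyticAt z) (f := F) (by
      filter_upwards [h2] with s hs
      rw [h s hs, Complex.conj_conj])
  have := congrFun this (conj s)
  simpa using this

open ComplexConjugate in
theorem ExtendedLindelofHypothesis.exists_differentiable {K : Type*} [Field K] [NumberField K]
    (hK : ExtendedLindelofHypothesis K) {η : ℝ} (hη : 0 < η) :
    ∃ (F : ℂ → ℂ) (C : ℝ), Differentiable ℂ F ∧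
      (∀ s : ℂ, 1 < s.re → dedekindZeta K s = F s + dedekindZeta_residue K * (s - 1)⁻¹) ∧
      ∀ σ ∈ Set.Icc (1 / 2 : ℝ) 2, ∀ t : ℝ, ‖F (σ + t * Complex.I)‖ ≤ C * (1 + |t|) ^ η := by
  obtain ⟨Z, hZ, hbound⟩ := hK
  obtain ⟨F, hF, hFZ⟩ := hZ.exists_differentiable
  obtain ⟨C, t₀, hC⟩ := hbound η hη
  have hne1 : ∀ s : ℂ, 1 < s.re → s ≠ 1 := by rintro s hs rfl; simp at hs
  have hFζ : ∀ s : ℂ, 1 < s.re → dedekindZeta K s = F s + dedekindZeta_residue K * (s - 1)⁻¹ := by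
    intro s hs
    rw [hFZ s (hne1 s hs), hZ.eq_dedekindZeta s hs]
    ring
  have hconj : ∀ s, F (conj s) = conj (F s) := by
    refine eq_conj_of_differentiable hF fun s hs => ?_
    have h1 := hFζ s hs
    have h2 := hFζ (conj s) (by simpa)
    rw [dedekindZeta_conj K hs, h1] at h2
    simp only [map_add, map_mul, map_inv₀, map_sub, map_one, Complex.conj_ofReal] at h2
    exact (add_right_cancel h2).symm
  set c := dedekindZeta_residue K with hc
  have hc0 : 0 ≤ c := (dedekindZeta_residue_pos K).le
  -- With `t ≥ 1` the polar term is at most `c`. The strip `|t| ≤ T` is handled by compactness, `F`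
  -- being entire.
  set T := max t₀ 1 with hT
  have hcompact : IsCompact (Set.Icc (1 / 2 : ℝ) 2 ×ˢ Set.Icc (-T) T) :=
    isCompact_Icc.prod isCompact_Icc
  obtain ⟨M, hM⟩ := hcompact.exists_bound_of_continuousOn
    (f := fun p : ℝ × ℝ => F (p.1 + p.2 * Complex.I))
    (hF.continuous.comp (by fun_prop)).continuousOn
  have hlarge : ∀ σ ∈ Set.Icc (1 / 2 : ℝ) 2, ∀ t : ℝ, T ≤ t →
      ‖F (σ + t * Complex.I)‖ ≤ (|C| + c) * (1 + |t|) ^ η := by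
    intro σ hσ t ht
    have ht1 : 1 ≤ t := (le_max_right _ _).trans ht
    have h1 : 1 ≤ ‖(σ : ℂ) + t * Complex.I - 1‖ := by
      have := Complex.abs_im_le_norm ((σ : ℂ) + t * Complex.I - 1)
      simp at this
      exact (ht1.trans (le_abs_self t)).trans this
    have hs1 : (σ : ℂ) + t * Complex.I ≠ 1 := by
      intro h
      rw [h] at h1
      norm_num at h1
    have hZt : ‖Z (σ + t * Complex.I)‖ ≤ |C| * (1 + |t|) ^ η := by
      refine (hC σ t hσ.1 ((le_max_left _ _).trans ht)).trans ?_
      gcongr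
      · exact le_abs_self C
      · linarith [le_abs_self t]
    rw [hFZ _ hs1, add_mul]
    refine (norm_sub_le _ _).trans (add_le_add hZt ?_)
    rw [norm_mul, norm_inv, Complex.norm_real, Real.norm_of_nonneg hc0]
    gcongr
    exact (inv_le_one_of_one_le₀ h1).trans (Real.one_le_rpow (by linarith [abs_nonneg t]) hη.le)
  refine ⟨F, |C| + c + |M|, hF, hFζ, fun σ hσ t => ?_⟩
  have hp : 0 ≤ (1 + |t|) ^ η := by positivity
  by_cases hpos : T ≤ t
  · refine (hlarge σ hσ t hpos).trans ?_
    exact mul_le_mul_of_nonneg_right (by linarith [abs_nonneg M]) hp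
  by_cases hneg : T ≤ -t
  · have h := hlarge σ hσ (-t) hneg
    have e : (σ : ℂ) + ((-t : ℝ) : ℂ) * Complex.I = conj ((σ : ℂ) + t * Complex.I) := by simp
    rw [e, hconj, RCLike.norm_conj, abs_neg] at h
    refine h.trans ?_
    exact mul_le_mul_of_nonneg_right (by linarith [abs_nonneg M]) hp
  · refine (hM (σ, t) ⟨hσ, by linarith, by linarith⟩).trans ?_
    have h1 : 1 ≤ (1 + |t|) ^ η := Real.one_le_rpow (by linarith [abs_nonneg t]) hη.le
    nlinarith [le_abs_self M, abs_nonneg M, abs_nonneg C]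

/-! ### Möbius inversion over finite sets of primes. -/

/-- The nonzero ideal which is the product of a finite set of primes. -/
noncomputable def primeProd {K : Type*} [Field K] [NumberField K]
    (T : Finset (HeightOneSpectrum (𝓞 K))) : (Ideal (𝓞 K))⁰ :=
  ∏ p ∈ T, ⟨p.asIdeal, mem_nonZeroDivisors_of_ne_zero p.ne_bot⟩

theorem coe_primeProd {K : Type*} [Field K] [NumberField K]
    (T : Finset (HeightOneSpectrum (𝓞 K))) :
    (primeProd T : Ideal (𝓞 K)) = ∏ p ∈ T, p.asIdeal := by
  rw [primeProd, Submonoid.coe_finsetProd]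

theorem primeProd_dvd_iff {K : Type*} [Field K] [NumberField K]
    (T : Finset (HeightOneSpectrum (𝓞 K))) (J : Ideal (𝓞 K)) :
    (primeProd T : Ideal (𝓞 K)) ∣ J ↔ ∀ p ∈ T, p.asIdeal ∣ J := by
  classical
  rw [coe_primeProd]
  refine ⟨fun h p hp => (Finset.dvd_prod_of_mem _ hp).trans h, fun h => ?_⟩
  have hinj : Function.Injective (fun p : HeightOneSpectrum (𝓞 K) => p.asIdeal) :=
    fun p q hpq => HeightOneSpectrum.ext hpq
  have := Finset.prod_primes_dvd (s := T.image fun p => p.asIdeal) J ?_ ?_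
  · rwa [Finset.prod_image hinj.injOn] at this
  · simp only [Finset.mem_image, forall_exists_index, and_imp, forall_apply_eq_imp_iff₂]
    exact fun p _ => p.prime
  · simpa using h

/-- The contributing `T` are the subsets of the finite set of primes dividing `J`; their signs
cancel unless that set is empty, that is, unless `J = ⊤`. -/
theorem hasSum_neg_one_pow_card_of_primeProd_dvd {K : Type*} [Field K] [NumberField K]
    (J : (Ideal (𝓞 K))⁰) [DecidablePred fun T : Finset (HeightOneSpectrum (𝓞 K)) =>
      (primeProd T : Ideal (𝓞 K)) ∣ J] [Decidable ((J : Ideal (𝓞 K)) = ⊤)] :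
    HasSum (fun T : Finset (HeightOneSpectrum (𝓞 K)) =>
      if (primeProd T : Ideal (𝓞 K)) ∣ J then (-1 : ℝ) ^ T.card else 0)
      (if (J : Ideal (𝓞 K)) = ⊤ then 1 else 0) := by
  classical
  have hJ : (J : Ideal (𝓞 K)) ≠ 0 := nonZeroDivisors.coe_ne_zero J
  have hfin := Ideal.finite_factors hJ
  have h := hasSum_sum_of_ne_finset_zero (L := .unconditional _)
    (f := fun T : Finset (HeightOneSpectrum (𝓞 K)) =>
      if (primeProd T : Ideal (𝓞 K)) ∣ J then (-1 : ℝ) ^ T.card else 0)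
    (s := hfin.toFinset.powerset) ?_
  · convert h using 1
    have hmem : ∀ T ∈ hfin.toFinset.powerset, (primeProd T : Ideal (𝓞 K)) ∣ J := by
      intro T hT
      rw [primeProd_dvd_iff]
      intro p hp
      simpa using Finset.mem_powerset.1 hT hp
    rw [Finset.sum_congr rfl fun T hT => if_pos (hmem T hT)]
    have h2 := congrArg (Int.cast : ℤ → ℝ)
      (Finset.sum_powerset_neg_one_pow_card (x := hfin.toFinset))
    push_cast at h2
    rw [h2]
    refine if_congr ?_ rfl rfl
    rw [Set.Finite.toFinset_eq_empty, Set.eq_empty_iff_forall_notMem]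
    constructor
    · intro h p hp
      rw [Set.mem_ofPred_eq, h, ← Ideal.one_eq_top] at hp
      exact p.prime.not_isUnit (isUnit_of_dvd_one hp)
    · intro h
      by_contra hne
      obtain ⟨M, hM, hle⟩ := Ideal.exists_le_maximal _ hne
      have hM0 : M ≠ ⊥ := by
        rintro rfl
        exact hJ (le_bot_iff.1 hle)
      exact h ⟨M, hM.isPrime, hM0⟩ (Ideal.dvd_iff_le.2 hle)
  · intro T hT
    refine if_neg fun hdvd => hT ?_
    rw [Finset.mem_powerset]
    intro p hp
    simpa using (primeProd_dvd_iff T _).1 hdvd p hp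

theorem absNorm_primeProd {K : Type*} [Field K] [NumberField K]
    (T : Finset (HeightOneSpectrum (𝓞 K))) :
    Ideal.absNorm (primeProd T : Ideal (𝓞 K)) = ∏ p ∈ T, Ideal.absNorm p.asIdeal := by
  rw [coe_primeProd, map_prod]

/-- The terms are those of the expanded product `∏ (1 + 𝔑𝔭^(-σ))`, which converges with `∑ 𝔑𝔭^(-σ)`.
-/
theorem summable_absNorm_primeProd_rpow (K : Type*) [Field K] [NumberField K] {σ : ℝ}
    (hσ : 1 < σ) :
    Summable fun T : Finset (HeightOneSpectrum (𝓞 K)) =>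
      (Ideal.absNorm (primeProd T : Ideal (𝓞 K)) : ℝ) ^ (-σ) := by
  have hinj : Function.Injective fun p : HeightOneSpectrum (𝓞 K) =>
      (⟨p.asIdeal, mem_nonZeroDivisors_of_ne_zero p.ne_bot⟩ : (Ideal (𝓞 K))⁰) :=
    fun p q hpq => HeightOneSpectrum.ext (congrArg Subtype.val hpq)
  refine (summable_finsetProd_of_summable_nonneg (fun p => ?_)
    ((summable_absNorm_rpow K hσ).comp_injective hinj)).congr fun T => ?_
  · exact Real.rpow_nonneg (Nat.cast_nonneg _) _
  · rw [absNorm_primeProd, Nat.cast_prod, ← Real.finsetProd_rpow _ _ fun _ _ => Nat.cast_nonneg _]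
    rfl

theorem tsum_neg_one_pow_card_mul_tsum_absNorm_rpow (K : Type*) [Field K] [NumberField K] {σ : ℝ}
    (hσ : 1 < σ) :
    (∑' T : Finset (HeightOneSpectrum (𝓞 K)),
      (-1 : ℝ) ^ T.card * (Ideal.absNorm (primeProd T : Ideal (𝓞 K)) : ℝ) ^ (-σ)) *
      ∑' I : (Ideal (𝓞 K))⁰, (Ideal.absNorm (I : Ideal (𝓞 K)) : ℝ) ^ (-σ) = 1 := by
  classical
  set u : (Ideal (𝓞 K))⁰ → ℝ := fun I => (Ideal.absNorm (I : Ideal (𝓞 K)) : ℝ) ^ (-σ) with hu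
  have hu0 : ∀ I, 0 ≤ u I := fun I => Real.rpow_nonneg (Nat.cast_nonneg _) _
  have humul : ∀ I J, u (I * J) = u I * u J := by
    intro I J
    simp only [hu, Submonoid.coe_mul, map_mul, Nat.cast_mul]
    rw [Real.mul_rpow (Nat.cast_nonneg _) (Nat.cast_nonneg _)]
  have hs1 : Summable fun T : Finset (HeightOneSpectrum (𝓞 K)) =>
      ‖(-1 : ℝ) ^ T.card * u (primeProd T)‖ := by
    refine (summable_absNorm_primeProd_rpow K hσ).congr fun T => ?_
    rw [norm_mul, norm_pow, norm_neg, norm_one, one_pow, one_mul, Real.norm_of_nonneg (hu0 _)]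
  have hs2 : Summable fun I => ‖u I‖ := (summable_absNorm_rpow K hσ).norm
  have hprod := (hs1.of_norm.hasSum.mul hs2.of_norm.hasSum (summable_mul_of_summable_norm hs1 hs2))
  -- Dirichlet convolution: `(T, I) ↦ (P_T I, T)` is a bijection onto the pairs `(J, T)` with `P_T ∣
  -- J`. Summing over `T` first leaves only `J = 1`.
  set e : Finset (HeightOneSpectrum (𝓞 K)) × (Ideal (𝓞 K))⁰ →
      (Ideal (𝓞 K))⁰ × Finset (HeightOneSpectrum (𝓞 K)) := fun x => (primeProd x.1 * x.2, x.1)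
    with he
  have heinj : Function.Injective e := by
    rintro ⟨T, I⟩ ⟨T', I'⟩ h
    simp only [he, Prod.mk.injEq] at h
    obtain ⟨h1, rfl⟩ := h
    have h1' := congrArg Subtype.val h1
    simp only [Submonoid.coe_mul] at h1'
    exact Prod.ext rfl (Subtype.ext (mul_left_cancel₀ (nonZeroDivisors.coe_ne_zero _) h1'))
  set f : (Ideal (𝓞 K))⁰ × Finset (HeightOneSpectrum (𝓞 K)) → ℝ := fun y =>
    u y.1 * if (primeProd y.2 : Ideal (𝓞 K)) ∣ y.1 then (-1 : ℝ) ^ y.2.card else 0 with hf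
  have hfe : (fun x : Finset (HeightOneSpectrum (𝓞 K)) × (Ideal (𝓞 K))⁰ =>
      (-1 : ℝ) ^ x.1.card * u (primeProd x.1) * u x.2) = f ∘ e := by
    ext ⟨T, I⟩
    simp only [hf, he, Function.comp, Submonoid.coe_mul, dvd_mul_right, if_true, humul]
    ring
  rw [hfe, heinj.hasSum_iff] at hprod
  · have h1 := hprod.prod_fiberwise
      fun J => (hasSum_neg_one_pow_card_of_primeProd_dvd J).mul_left (u J)
    refine h1.unique ?_
    convert! hasSum_ite_eq (1 : (Ideal (𝓞 K))⁰) (1 : ℝ) using 1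
    ext J
    by_cases hJ : J = 1
    · subst hJ
      simp [hu]
    · have : (J : Ideal (𝓞 K)) ≠ ⊤ := fun h => hJ (Subtype.ext (by simpa using h))
      simp [hJ, this]
  · rintro ⟨J, T⟩ hy
    simp only [hf]
    rw [if_neg, mul_zero]
    intro hdvd
    obtain ⟨I, hI⟩ := nonZeroDivisors_dvd_iff_dvd_coe.2 hdvd
    exact hy ⟨(T, I), by simp [he, hI]⟩

theorem tsum_neg_one_pow_card_mul_absNorm_rpow (K : Type*) [Field K] [NumberField K] {σ : ℝ}
    (hσ : 1 < σ) :
    ((∑' T : Finset (HeightOneSpectrum (𝓞 K)),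
      (-1 : ℝ) ^ T.card * (Ideal.absNorm (primeProd T : Ideal (𝓞 K)) : ℝ) ^ (-σ) : ℝ) : ℂ) =
      (dedekindZeta K σ)⁻¹ := by
  have h := tsum_neg_one_pow_card_mul_tsum_absNorm_rpow K hσ
  have h2 : dedekindZeta K σ =
      ((∑' I : (Ideal (𝓞 K))⁰, (Ideal.absNorm (I : Ideal (𝓞 K)) : ℝ) ^ (-σ) : ℝ) : ℂ) := by
    rw [← (hasSum_absNorm_cpow K (s := σ) (by simpa)).tsum_eq, Complex.ofReal_tsum]
    refine tsum_congr fun I => ?_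
    rw [Complex.ofReal_cpow (Nat.cast_nonneg _)]
    simp
  rw [h2]
  refine eq_inv_of_mul_eq_one_left ?_
  exact_mod_cast h

/-! ### Inclusion-exclusion for visible points. -/

/-- The number of nonzero ideals of norm at most `x`. -/
noncomputable def idealCount (K : Type*) [Field K] [NumberField K] (x : ℝ) : ℕ :=
  {I : (Ideal (𝓞 K))⁰ | (Ideal.absNorm (I : Ideal (𝓞 K)) : ℝ) ≤ x}.ncard

theorem finite_setOf_absNorm_le (K : Type*) [Field K] [NumberField K] (x : ℝ) :
    {I : Ideal (𝓞 K) | (Ideal.absNorm I : ℝ) ≤ x}.Finite := by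
  have h : {I : Ideal (𝓞 K) | Ideal.absNorm I ≤ ⌊x⌋₊}.Finite :=
    Ideal.finite_setOfPred_absNorm_le ⌊x⌋₊
  exact h.subset fun I hI => Nat.le_floor hI

theorem finite_setOf_nonZeroDivisors_absNorm_le (K : Type*) [Field K] [NumberField K] (x : ℝ) :
    {I : (Ideal (𝓞 K))⁰ | (Ideal.absNorm (I : Ideal (𝓞 K)) : ℝ) ≤ x}.Finite :=
  (finite_setOf_absNorm_le K x).preimage Subtype.val_injective.injOn

theorem ncard_setOf_dvd_absNorm_le {K : Type*} [Field K] [NumberField K] (D : (Ideal (𝓞 K))⁰)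
    (x : ℝ) :
    {I : (Ideal (𝓞 K))⁰ | (Ideal.absNorm (I : Ideal (𝓞 K)) : ℝ) ≤ x ∧
      (D : Ideal (𝓞 K)) ∣ I}.ncard = idealCount K (x / Ideal.absNorm (D : Ideal (𝓞 K))) := by
  have hD : (0 : ℝ) < Ideal.absNorm (D : Ideal (𝓞 K)) :=
    Nat.cast_pos.2 (Ideal.absNorm_pos_of_nonZeroDivisors D)
  have hinj : Function.Injective fun I : (Ideal (𝓞 K))⁰ => D * I := by
    intro I J h
    have h1 := congrArg Subtype.val h
    exact Subtype.ext (mul_left_cancel₀ (nonZeroDivisors.coe_ne_zero D) h1)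
  rw [idealCount, ← Set.ncard_image_of_injective
    {I : (Ideal (𝓞 K))⁰ | (Ideal.absNorm (I : Ideal (𝓞 K)) : ℝ) ≤
      x / Ideal.absNorm (D : Ideal (𝓞 K))} hinj]
  congr 1
  ext J
  simp only [Set.mem_ofPred_eq, Set.mem_image, le_div_iff₀ hD]
  constructor
  · rintro ⟨h1, h2⟩
    obtain ⟨I, rfl⟩ := nonZeroDivisors_dvd_iff_dvd_coe.2 h2
    refine ⟨I, ?_, rfl⟩
    simpa [mul_comm] using h1
  · rintro ⟨I, h1, rfl⟩
    refine ⟨?_, by simp⟩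
    simpa [mul_comm] using h1

/-- Möbius inversion is applied to `J = ∑ a_i`, which is nonzero because `m ≠ 0`. As `P_T` divides
the sum exactly when it divides every `a_i`, the tuples for a given `T` form an `m`-th power. -/
theorem hasSum_visibleCount (K : Type*) [Field K] [NumberField K] {m : ℕ} (hm : m ≠ 0) (x : ℝ) :
    HasSum (fun T : Finset (HeightOneSpectrum (𝓞 K)) => (-1 : ℝ) ^ T.card *
      (idealCount K (x / Ideal.absNorm (primeProd T : Ideal (𝓞 K))) : ℝ) ^ m)
      (visibleCount K m x) := by
  classical
  have : NeZero m := ⟨hm⟩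
  set A := (finite_setOf_nonZeroDivisors_absNorm_le K x).toFinset with hA
  set B : Finset (Fin m → (Ideal (𝓞 K))⁰) := Fintype.piFinset fun _ => A with hB
  have hmemA : ∀ I, I ∈ A ↔ (Ideal.absNorm (I : Ideal (𝓞 K)) : ℝ) ≤ x := by simp [hA]
  have hsum0 : ∀ a : Fin m → (Ideal (𝓞 K))⁰, (∑ i, (a i : Ideal (𝓞 K))) ≠ 0 := by
    intro a h
    have h1 : (a 0 : Ideal (𝓞 K)) ≤ ∑ i, (a i : Ideal (𝓞 K)) := by
      rw [Ideal.sum_eq_sup]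
      exact Finset.le_sup (f := fun i => (a i : Ideal (𝓞 K))) (Finset.mem_univ 0)
    rw [h] at h1
    exact nonZeroDivisors.coe_ne_zero (a 0) (le_bot_iff.1 h1)
  have hdvd : ∀ (D : Ideal (𝓞 K)) (a : Fin m → (Ideal (𝓞 K))⁰),
      D ∣ ∑ i, (a i : Ideal (𝓞 K)) ↔ ∀ i, D ∣ a i := by
    intro D a
    simp only [Ideal.dvd_iff_le, Ideal.sum_eq_sup, Finset.sup_le_iff, Finset.mem_univ, true_imp_iff]
  have h := hasSum_sum (s := B) fun a _ => hasSum_neg_one_pow_card_of_primeProd_dvd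
    ⟨∑ i, (a i : Ideal (𝓞 K)), mem_nonZeroDivisors_of_ne_zero (hsum0 a)⟩
  convert! h using 1
  · ext T
    simp only [hdvd, ← Finset.sum_filter, Finset.sum_const, nsmul_eq_mul]
    rw [mul_comm, ← Nat.cast_pow]
    congr 2
    have : B.filter (fun a => ∀ i, (primeProd T : Ideal (𝓞 K)) ∣ a i) =
        Fintype.piFinset fun _ : Fin m => A.filter fun I : (Ideal (𝓞 K))⁰ =>
          (primeProd T : Ideal (𝓞 K)) ∣ I := by
      ext a
      simp only [hB, Finset.mem_filter, Fintype.mem_piFinset, forall_and]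
    rw [this, Fintype.card_piFinset_const, ← ncard_setOf_dvd_absNorm_le, ← Set.ncard_coe_finset]
    congr 2
    ext I
    simp [hmemA]
  · rw [← Finset.sum_filter, Finset.sum_const, nsmul_eq_mul, mul_one, visibleCount,
      ← Set.ncard_coe_finset]
    congr 1
    have hinj : Function.Injective fun (a : Fin m → (Ideal (𝓞 K))⁰) (i : Fin m) =>
        (a i : Ideal (𝓞 K)) := fun a b hab => funext fun i => Subtype.ext (congrFun hab i)
    rw [← Set.ncard_image_of_injective _ hinj]
    congr 1
    ext a
    simp only [visiblePoints, Set.mem_ofPred_eq, Set.mem_image, Finset.mem_coe, Finset.mem_filter,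
      hB, Fintype.mem_piFinset, hmemA]
    constructor
    · rintro ⟨h1, h2, h3⟩
      exact ⟨fun i => ⟨a i, mem_nonZeroDivisors_of_ne_zero (h1 i)⟩, ⟨h2, h3⟩, rfl⟩
    · rintro ⟨b, ⟨h1, h2⟩, rfl⟩
      exact ⟨fun i => nonZeroDivisors.coe_ne_zero (b i), h1, h2⟩

/-! ### Error estimates. -/

theorem ExtendedLindelofHypothesis.exists_abs_idealCount_sub_le {K : Type*} [Field K]
    [NumberField K] (hK : ExtendedLindelofHypothesis K) {δ : ℝ} (hδ : 0 < δ) (hδ' : δ ≤ 1) :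
    ∃ B : ℝ, 0 ≤ B ∧ ∀ x : ℝ, 1 ≤ x →
      |(idealCount K x : ℝ) - dedekindZeta_residue K * x| ≤ B * x ^ (1 / 2 + δ) := by
  obtain ⟨F, C, hF, hFζ, hC⟩ := hK.exists_differentiable (half_pos hδ)
  refine exists_abs_ncard_sub_le (ν := fun I : (Ideal (𝓞 K))⁰ =>
    (Ideal.absNorm (I : Ideal (𝓞 K)) : ℝ))
    (fun I => Nat.cast_pos.2 (Ideal.absNorm_pos_of_nonZeroDivisors I))
    (finite_setOf_nonZeroDivisors_absNorm_le K) (summable_absNorm_rpow K one_lt_two)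
    (dedekindZeta_residue_pos K).le (fun t => ?_) hF (half_lt_self hδ) hδ.le hδ' hC
  have hs : 1 < (((2 : ℝ) : ℂ) + t * Complex.I).re := by simp
  rw [← hFζ _ hs]
  simpa only [Complex.ofReal_natCast] using hasSum_absNorm_cpow K hs

theorem idealCount_eq_zero_of_lt_one (K : Type*) [Field K] [NumberField K] {x : ℝ} (hx : x < 1) :
    idealCount K x = 0 := by
  rw [idealCount, Set.ncard_eq_zero (finite_setOf_nonZeroDivisors_absNorm_le K x),
    Set.eq_empty_iff_forall_notMem]
  intro I hI
  have h1 : (1 : ℝ) ≤ Ideal.absNorm (I : Ideal (𝓞 K)) := by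
    exact_mod_cast Ideal.absNorm_pos_of_nonZeroDivisors I
  exact absurd (h1.trans hI) (not_le.2 hx)

/-- Valid for all `y > 0`, so the sum over `T` needs no truncation at `𝔑P_T ≤ x`. For `y < 1` the
count is 0 and `y^m ≤ y^(m-1/2+δ)` by `δ ≤ 1/2`; for `y ≥ 1` one factors the difference of powers.
-/
theorem ExtendedLindelofHypothesis.exists_abs_idealCount_pow_sub_le {K : Type*} [Field K]
    [NumberField K] (hK : ExtendedLindelofHypothesis K) {m : ℕ} (hm : m ≠ 0) {δ : ℝ} (hδ : 0 < δ)
    (hδ' : δ ≤ 1 / 2) :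
    ∃ B : ℝ, ∀ y : ℝ, 0 < y →
      |(idealCount K y : ℝ) ^ m - (dedekindZeta_residue K * y) ^ m| ≤
        B * y ^ ((m : ℝ) - 1 / 2 + δ) := by
  obtain ⟨B, hB, h⟩ := hK.exists_abs_idealCount_sub_le hδ (by linarith)
  set c := dedekindZeta_residue K
  have hc : 0 ≤ c := (dedekindZeta_residue_pos K).le
  have hm1 : ((m - 1 : ℕ) : ℝ) = m - 1 := by
    rw [Nat.cast_sub (Nat.one_le_iff_ne_zero.2 hm), Nat.cast_one]
  refine ⟨B * m * (c + B) ^ (m - 1) + c ^ m, fun y hy => ?_⟩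
  have hpow : 0 ≤ y ^ ((m : ℝ) - 1 / 2 + δ) := by positivity
  rcases lt_or_ge y 1 with hy1 | hy1
  · rw [idealCount_eq_zero_of_lt_one K hy1, Nat.cast_zero, zero_pow hm, zero_sub, abs_neg,
      abs_of_nonneg (by positivity), mul_pow]
    have h1 : y ^ m ≤ y ^ ((m : ℝ) - 1 / 2 + δ) := by
      rw [← Real.rpow_natCast]
      exact Real.rpow_le_rpow_of_exponent_ge hy hy1.le (by linarith)
    calc c ^ m * y ^ m ≤ c ^ m * y ^ ((m : ℝ) - 1 / 2 + δ) := by gcongr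
      _ ≤ _ := by
        gcongr
        have : 0 ≤ B * m * (c + B) ^ (m - 1) := by positivity
        linarith
  · have h1 := h y hy1
    have h2 : y ^ (1 / 2 + δ) ≤ y := by
      calc y ^ (1 / 2 + δ) ≤ y ^ (1 : ℝ) := Real.rpow_le_rpow_of_exponent_le hy1 (by linarith)
        _ = y := Real.rpow_one y
    have h3 : (idealCount K y : ℝ) ≤ (c + B) * y := by
      have := (abs_le.1 h1).2
      nlinarith
    have h4 : max |(idealCount K y : ℝ)| |c * y| ≤ (c + B) * y := by
      rw [abs_of_nonneg (Nat.cast_nonneg _), abs_of_nonneg (by positivity)]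
      exact max_le h3 (by nlinarith)
    have h5 : y ^ (1 / 2 + δ) * y ^ (m - 1) = y ^ ((m : ℝ) - 1 / 2 + δ) := by
      rw [← Real.rpow_natCast y (m - 1), ← Real.rpow_add hy, hm1]
      congr 1
      ring
    calc _ ≤ |(idealCount K y : ℝ) - c * y| * m *
          max |(idealCount K y : ℝ)| |c * y| ^ (m - 1) := abs_pow_sub_pow_le ..
      _ ≤ (B * y ^ (1 / 2 + δ)) * m * ((c + B) * y) ^ (m - 1) := by gcongr
      _ = B * m * (c + B) ^ (m - 1) * (y ^ (1 / 2 + δ) * y ^ (m - 1)) := by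
          rw [mul_pow]; ring
      _ = B * m * (c + B) ^ (m - 1) * y ^ ((m : ℝ) - 1 / 2 + δ) := by rw [h5]
      _ ≤ _ := by
        gcongr
        have : 0 ≤ c ^ m := by positivity
        linarith

theorem ExtendedLindelofHypothesis.exists_norm_visibleError_le {K : Type*} [Field K]
    [NumberField K] (hK : ExtendedLindelofHypothesis K) {m : ℕ} (hm : 2 ≤ m) {δ : ℝ} (hδ : 0 < δ)
    (hδ' : δ ≤ 1 / 2) :
    ∃ C : ℝ, ∀ x : ℝ, 0 < x → ‖visibleError K m x‖ ≤ C * x ^ ((m : ℝ) - 1 / 2 + δ) := by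
  obtain ⟨B, hB⟩ := hK.exists_abs_idealCount_pow_sub_le (m := m) (by omega) hδ hδ'
  have hm2 : (2 : ℝ) ≤ m := by exact_mod_cast hm
  set c := dedekindZeta_residue K with hc
  set e : ℝ := (m : ℝ) - 1 / 2 + δ with he
  set n : Finset (HeightOneSpectrum (𝓞 K)) → ℝ := fun T =>
    (Ideal.absNorm (primeProd T : Ideal (𝓞 K)) : ℝ) with hn
  have hnpos : ∀ T, 0 < n T := fun T => Nat.cast_pos.2 (Ideal.absNorm_pos_of_nonZeroDivisors _)
  have hse : Summable fun T => n T ^ (-e) := summable_absNorm_primeProd_rpow K (by linarith)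
  have hsm : Summable fun T => (-1 : ℝ) ^ T.card * n T ^ (-(m : ℝ)) := by
    refine Summable.of_norm ((summable_absNorm_primeProd_rpow K
      (show (1 : ℝ) < m by linarith)).congr fun T => ?_)
    rw [norm_mul, norm_pow, norm_neg, norm_one, one_pow, one_mul,
      Real.norm_of_nonneg (Real.rpow_nonneg (hnpos T).le _)]
  refine ⟨B * ∑' T, n T ^ (-e), fun x hx => ?_⟩
  have h1 := hasSum_visibleCount K (m := m) (by omega) x
  have h2 := hsm.hasSum.mul_left ((c * x) ^ m)
  have h3 := h1.sub h2
  have hE : visibleError K m x = (((visibleCount K m x : ℝ) -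
      (c * x) ^ m * ∑' T, (-1 : ℝ) ^ T.card * n T ^ (-(m : ℝ)) : ℝ) : ℂ) := by
    have h := tsum_neg_one_pow_card_mul_absNorm_rpow K (σ := m) (by linarith)
    change ((∑' T, (-1 : ℝ) ^ T.card * n T ^ (-(m : ℝ)) : ℝ) : ℂ) = _ at h
    rw [visibleError, Complex.ofReal_sub, Complex.ofReal_mul ((c * x) ^ m), h, div_eq_mul_inv]
    push_cast
    rfl
  rw [hE, Complex.norm_real, ← h3.tsum_eq]
  -- Termwise, with `y = x / n T`; the exponent `e` exceeds 1, so the bounds are summable.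
  refine tsum_of_norm_bounded (g := fun T => B * x ^ e * n T ^ (-e)) ?_ fun T => ?_
  · rw [mul_right_comm]
    exact hse.hasSum.mul_left _
  · have hT := hB (x / n T) (div_pos hx (hnpos T))
    have e1 : (c * x) ^ m * ((-1 : ℝ) ^ T.card * n T ^ (-(m : ℝ))) =
        (-1 : ℝ) ^ T.card * (c * (x / n T)) ^ m := by
      rw [Real.rpow_neg (hnpos T).le, Real.rpow_natCast, ← mul_div_assoc, div_pow]
      ring
    rw [e1, ← mul_sub, norm_mul, norm_pow, norm_neg, norm_one, one_pow, one_mul, Real.norm_eq_abs]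
    refine hT.trans_eq ?_
    rw [Real.div_rpow hx.le (hnpos T).le, Real.rpow_neg (hnpos T).le]
    ring

end

theorem theorem4p1 (K : Type*) [Field K] [NumberField K] (hK : ExtendedLindelofHypothesis K)
    (m : ℕ) (hm : 2 ≤ m) (ε : ℝ) (hε : 0 < ε) :
    (fun x : ℝ => visibleError K m x) =O[atTop] fun x : ℝ => x ^ ((m : ℝ) - 1 / 2 + ε) := by
  obtain ⟨C, hC⟩ := hK.exists_norm_visibleError_le hm (lt_min hε (half_pos one_pos))
    (min_le_right ε (1 / 2))
  refine IsBigO.of_bound |C| ?_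
  filter_upwards [eventually_ge_atTop 1] with x hx
  have hx0 : 0 < x := by linarith
  refine (hC x hx0).trans ?_
  rw [Real.norm_of_nonneg (by positivity)]
  gcongr
  · exact le_abs_self C
  · exact min_le_left _ _
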